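/- **Setting.** Let $d\ge 0$, $n\ge 2$, $n_e\ge 1$ be integers, $X=[0,1]^d$, and let $\mathcal M$ be a function from $X$ to $\{-1,0,+1\}$ (for instance: $0$ on a hypersurface $M$ separating $X$ into two parts, and the label $\mp1$ of the part elsewhere). Let $G$ be the regular grid of $n^d$ points of $X$ with coordinates in $\{0,\frac1{n-1},\dots,1\}$, and assume $\mathcal M(v)\neq 0$ at every grid point $v$. The cubes of $G$ are the $d$-dimensional cubes of edge size $\frac{1}{n-1}$ whose vertices are grid points; $\mathcal F_i(\cdot)$ denotes the $i$-dimensional faces, $\mathcal F(\cdot)$ all faces (a cube is a face of itself), $\mathcal V(\cdot)$ the vertices, and $[\cdot]$ the convex hull. *Boundary points.* On every edge $[v_-,v_+]$ with $\mathcal M(v_-)=-1$, $\mathcal M(v_+)=+1$, one boundary point $v_-+\frac{i+1/2}{n_e}(v_+-v_-)$ is given, where $i\in\{0,\dots,n_e-1\}$ is any index such that $\mathcal M(v_-+\frac{i}{n_e}(v_+-v_-))=-1$ and $\mathcal M(v_-+\frac{i+1}{n_e}(v_+-v_-))=+1$ (such indices are assumed to exist). $B_M(F)$ is the set of boundary points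 on the edges of a face $F$, and $\bar B_M(F)$ is its barycentre. *Resistar.* For a cube $C$ with $B_M(C)\ne\emptyset$, $[B_M(C)]^\star$ is the union of the sets $[\{\bar B_M(F_1),\dots,\bar B_M(F_{d-1}),\bar B_M(C)\}]$ over all chains $F_1\subset\dots\subset F_{d-1}\subset F_d=C$ with $F_i\in\mathcal F_i(C)$ and $B_M(F_1)\neq\emptyset$. The set $[B_M(G)]^\star$ is the union of the $[B_M(C)]^\star$ over the cubes $C$ of $G$ with $B_M(C)\neq\emptyset$. *Classification in a cube.* For a cube $C$ with $B_M(C)\ne\emptyset$ and a set $D$, let $[B_M(C)]^{\mathcal D\star}(D)$ be the union of the sets $[\mathcal V(F_h)\cup\{\bar B_M(F_{h+1}),\dots,\bar B_M(F_{d-1}),\bar B_M(C)\}]$ over all $0\le h\le d-1$ and all chains $F_h\subset\dots\subset F_{d-1}\subset F_d=C$ with $F_i\in\mathcal F_i(C)$, $F_h\subset D$ and $B_M(F_{h+1})\neq\emptyset$. For $x\in C$, $[B_M(C)]^\star(x)$ is $\mathcal M(v)$, $v\in\mathcal V(C)$, if $B_M(C)=\emptyset$; otherwise it is $0$ if $x\in[B_M(C)]^\star$,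 and else $\mathcal M(v)$ for the grid points $v$ of the unique connected component $D$ of the union of the faces $F\in\mathcal F(C)$ with $B_M(F)=\emptyset$ such that $x\in[B_M(C)]^{\mathcal D\star}(D)$. *Classification on the grid.* Let $\mathcal D_G$ be the set of connected components of the union of all faces $F\in\mathcal F(G)$ (of all dimensions $0,\dots,d$) with $B_M(F)=\emptyset$. For $D\in\mathcal D_G$, let $[B_G]^{\mathcal D\star}(D)$ be the union over the cubes $C$ of $G$ of: $\emptyset$ if $D\cap C=\emptyset$; $C$ if $D\cap C=C$; $[B_M(C)]^{\mathcal D\star}(D\cap C)$ otherwise. For $x\in X$, $[B_M(G)]^\star(x)=0$ if $x\in[B_M(G)]^\star$; otherwise it is $\mathcal M(v)$ for the grid points $v$ of the unique $D\in\mathcal D_G$ with $x\in[B_G]^{\mathcal D\star}(D)$. *Algorithm.* Let $C_G$ be the set of cubes $C$ of $G$ with $B_M(C)\ne\emptyset$, and let $m$ be the centre of an arbitrarily chosen cube of $C_G$. Given $x\in X$, let $\mathscr C=\{C\in C_G:\ C\cap[x,m]\ne\emptyset\}$; for each $C\in\mathscr C$ let $x'(C)$ be a point of $[x,m]\cap C$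 nearest to $x$; let $C'_x\in\mathscr C$ minimise $\|x-x'(C)\|$ over $C \in \mathscr C$ (ties being broken arbitrarily); return $[B_M(C'_x)]^\star(x'(C'_x))$. **Proposition.** For every such choice of boundary points, every cube of $C_G$ with centre $m$ and every $x\in X$: the value $[B_M(G)]^\star(x)$ is well defined, the algorithm returns a value, and, however the choices in it are made, this value is $[B_M(G)]^\star(x)$. -/

import Mathlib

namespace Resistar

/-- The ambient Euclidean space `ℝ^d`. -/
abbrev Pt (d : ℕ) : Type := EuclideanSpace ℝ (Fin d)

/-- Indices of the points of the regular grid with `n` points on each of the `d` axes. -/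
abbrev Vtx (d n : ℕ) : Type := Fin d → Fin n

/-- The compact set `X = [0, 1]^d`. -/
def unitCube (d : ℕ) : Set (Pt d) := {x | ∀ j, 0 ≤ x j ∧ x j ≤ 1}

/-- The grid point of index `v`: its coordinates are `v j * ε` with `ε = 1 / (n - 1)`. -/
noncomputable def gridPoint {d n : ℕ} (v : Vtx d n) : Pt d :=
  WithLp.toLp 2 (fun j => ((v j : ℕ) : ℝ) * (1 / ((n : ℝ) - 1)))

/-- The faces of all dimensions of the grid (its cubes and vertices included): the products of
intervals whose endpoints on each axis are equal or adjacent grid coordinates. -/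
@[ext]
structure GridFace (d n : ℕ) where
  /-- the lowest vertex -/
  lo : Vtx d n
  /-- the highest vertex -/
  hi : Vtx d n
  lo_le_hi : ∀ j, lo j ≤ hi j
  hi_le_succ : ∀ j, (hi j : ℕ) ≤ (lo j : ℕ) + 1

namespace GridFace

variable {d n : ℕ}

/-- The face as a set of points. -/
def toSet (F : GridFace d n) : Set (Pt d) :=
  {x | ∀ j, gridPoint F.lo j ≤ x j ∧ x j ≤ gridPoint F.hi j}

/-- The dimension of the face: the number of axes along which it is not reduced to a point. -/
def dim (F : GridFace d n) : ℕ := (Finset.univ.filter (fun j => F.lo j ≠ F.hi j)).card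

/-- The vertices `𝒱(F)` of the face (as grid indices). -/
def verts (F : GridFace d n) : Set (Vtx d n) := {v | ∀ j, v j = F.lo j ∨ v j = F.hi j}

/-- The centre of the face. -/
noncomputable def centre (F : GridFace d n) : Pt d :=
  midpoint ℝ (gridPoint F.lo) (gridPoint F.hi)

end GridFace

/-- `u` and `w` are the two endpoints of an edge of the grid. -/
def IsEdge {d n : ℕ} (u w : Vtx d n) : Prop :=
  ∃ j, ((u j : ℕ) + 1 = w j ∨ (w j : ℕ) + 1 = u j) ∧ ∀ k, k ≠ j → u k = w k

/-- `[v₋, v₊]` is an edge of the grid, with `𝓜(v₋) = -1` and `𝓜(v₊) = +1`. -/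
def IsCutEdge {d n : ℕ} (M : Pt d → SignType) (vm vp : Vtx d n) : Prop :=
  IsEdge vm vp ∧ M (gridPoint vm) = -1 ∧ M (gridPoint vp) = 1

/-- `b v₋ v₊` is a boundary point `b_M([v₋, v₊])` for every edge `[v₋, v₊]` with `𝓜(v₋) = -1` and
`𝓜(v₊) = +1`: the middle of a piece of the edge, divided into `ne` equal pieces, at the endpoints
of which `𝓜` is respectively `-1` and `+1`. (The values of `b` at other pairs are never used.) -/
def IsBoundaryPointChoice {d n : ℕ} (M : Pt d → SignType) (ne : ℕ)
    (b : Vtx d n → Vtx d n → Pt d) : Prop :=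
  ∀ vm vp : Vtx d n, IsCutEdge M vm vp → ∃ i : ℕ, i < ne ∧
    M (gridPoint vm + ((i : ℝ) / (ne : ℝ)) • (gridPoint vp - gridPoint vm)) = -1 ∧
    M (gridPoint vm + (((i : ℝ) + 1) / (ne : ℝ)) • (gridPoint vp - gridPoint vm)) = 1 ∧
    b vm vp = gridPoint vm + (((i : ℝ) + 1 / 2) / (ne : ℝ)) • (gridPoint vp - gridPoint vm)

section

variable {d n : ℕ} (M : Pt d → SignType) (b : Vtx d n → Vtx d n → Pt d)

open Classical in
/-- `B_M(F)`: the finite set of the boundary points defined on the edges of `F`. -/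
noncomputable def boundaryPoints (F : GridFace d n) : Finset (Pt d) :=
  (Finset.univ.filter (fun p : Vtx d n × Vtx d n =>
    IsCutEdge M p.1 p.2 ∧ p.1 ∈ F.verts ∧ p.2 ∈ F.verts)).image (fun p => b p.1 p.2)

/-- The barycentre of the boundary points of `F`, meaningful if `B_M(F) ≠ ∅`. -/
noncomputable def bary (F : GridFace d n) : Pt d :=
  ((boundaryPoints M b F).card : ℝ)⁻¹ • ∑ p ∈ boundaryPoints M b F, p

/-- `F_h ⊂ F_{h+1} ⊂ … ⊂ F_{d-1} ⊂ F_d = C` with `F_i` a face of dimension `i` of the cube `C`,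
for `h ≤ i ≤ d - 1`. The values `F i` for other indices `i` are never used. -/
def IsFaceChain (C : GridFace d n) (h : ℕ) (F : ℕ → GridFace d n) : Prop :=
  F d = C ∧ (∀ i, h ≤ i → i ≤ d → (F i).dim = i) ∧
    ∀ i, h ≤ i → i < d → (F i).toSet ⊆ (F (i + 1)).toSet

/-- The c-resistar `[B_M(C)]^⋆` in the cube `C`, meaningful if `B_M(C) ≠ ∅`: the union, over the
chains `F_1 ⊂ … ⊂ F_{d-1} ⊂ F_d = C` with `B_M(F_1) ≠ ∅`, of the convex hulls of the barycentres of
`B_M(F_1), …, B_M(F_{d-1}), B_M(C)`. -/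
def cubeResistar (C : GridFace d n) : Set (Pt d) :=
  {x | ∃ F : ℕ → GridFace d n, IsFaceChain C 1 F ∧ (boundaryPoints M b (F 1)).Nonempty ∧
    x ∈ convexHull ℝ ((fun i => bary M b (F i)) '' Set.Icc 1 d)}

/-- The connected components of a set `U`. -/
def components (U : Set (Pt d)) : Set (Set (Pt d)) :=
  {D | ∃ x ∈ U, D = connectedComponentIn U x}

/-- `𝒟(B, C)`: the connected components of the union of the faces of `C` (`C` itself included)
without boundary points. -/
def cubeComponents (C : GridFace d n) : Set (Set (Pt d)) :=
  components (⋃ F ∈ {F : GridFace d n | F.toSet ⊆ C.toSet ∧ boundaryPoints M b F = ∅}, F.toSet)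

/-- The classification set `[B]^{𝒟⋆}(D)` in the cube `C`: the union, over the chains
`F_h ⊂ … ⊂ F_{d-1} ⊂ F_d = C`, `0 ≤ h ≤ d - 1`, with `F_h ⊂ D` and `B_M(F_{h+1}) ≠ ∅`, of the convex
hulls of the vertices of `F_h` and the barycentres of `B_M(F_{h+1}), …, B_M(F_{d-1}), B_M(C)`. -/
def cubeClassSet (C : GridFace d n) (D : Set (Pt d)) : Set (Pt d) :=
  {x | ∃ (h : ℕ) (F : ℕ → GridFace d n), h < d ∧ IsFaceChain C h F ∧ (F h).toSet ⊆ D ∧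
    (boundaryPoints M b (F (h + 1))).Nonempty ∧
    x ∈ convexHull ℝ (gridPoint '' (F h).verts ∪ (fun i => bary M b (F i)) '' Set.Icc (h + 1) d)}

/-- `s` is the common value of `𝓜` at the grid points contained in `D` (of which there are some). -/
def IsLabelOf (n : ℕ) (M : Pt d → SignType) (D : Set (Pt d)) (s : SignType) : Prop :=
  (∃ v : Vtx d n, gridPoint v ∈ D) ∧ ∀ v : Vtx d n, gridPoint v ∈ D → M (gridPoint v) = s

/-- `[B_M(C)]^⋆(x) = s` (for a point `x` of the cube `C`). -/
def IsCubeClass (C : GridFace d n) (x : Pt d) (s : SignType) : Prop :=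
  (boundaryPoints M b C = ∅ ∧ ∀ v ∈ C.verts, M (gridPoint v) = s) ∨
  ((boundaryPoints M b C).Nonempty ∧
    ((x ∈ cubeResistar M b C ∧ s = 0) ∨
     (x ∉ cubeResistar M b C ∧ ∃ D ∈ cubeComponents M b C, x ∈ cubeClassSet M b C D ∧
        (∀ D' ∈ cubeComponents M b C, x ∈ cubeClassSet M b C D' → D' = D) ∧
        IsLabelOf n M D s)))

/-- The c-resistar approximation `[B_M(G)]^⋆` on the grid: the union of the c-resistars of the
cubes `C` of the grid with `B_M(C) ≠ ∅`. -/
def gridResistar : Set (Pt d) :=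
  ⋃ C ∈ {C : GridFace d n | C.dim = d ∧ (boundaryPoints M b C).Nonempty}, cubeResistar M b C

/-- `𝒟(B_G, G)`: the connected components of the union of all faces of the grid without boundary
points. -/
def gridComponents : Set (Set (Pt d)) :=
  components (⋃ F ∈ {F : GridFace d n | boundaryPoints M b F = ∅}, F.toSet)

open Classical in
/-- The part in the cube `C` of the classification set of `D` on the grid. -/
noncomputable def gridClassPiece (C : GridFace d n) (D : Set (Pt d)) : Set (Pt d) :=
  if D ∩ C.toSet = ∅ then ∅
  else if D ∩ C.toSet = C.toSet then C.toSet
  else cubeClassSet M b C (D ∩ C.toSet)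

/-- The classification set `[B_G]^{𝒟⋆}(D)` on the grid. -/
noncomputable def gridClassSet (D : Set (Pt d)) : Set (Pt d) :=
  ⋃ C ∈ {C : GridFace d n | C.dim = d}, gridClassPiece M b C D

/-- `[B_M(G)]^⋆(x) = s` (for a point `x` of `X`). -/
def IsGridClass (x : Pt d) (s : SignType) : Prop :=
  (x ∈ gridResistar M b ∧ s = 0) ∨
  (x ∉ gridResistar M b ∧ ∃ D ∈ gridComponents M b, x ∈ gridClassSet M b D ∧
    (∀ D' ∈ gridComponents M b, x ∈ gridClassSet M b D' → D' = D) ∧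
    IsLabelOf n M D s)

/-- `C_G`: the cubes of the grid containing boundary points. -/
def nonemptyCubes : Set (GridFace d n) :=
  {C | C.dim = d ∧ (boundaryPoints M b C).Nonempty}

/-- The cubes of `C_G` that meet the segment `[x, m]`. -/
def cubesOnSegment (m x : Pt d) : Set (GridFace d n) :=
  {C | C ∈ nonemptyCubes M b ∧ (C.toSet ∩ segment ℝ x m).Nonempty}

/-- The whole-grid algorithm, run with the reference point `m` on the input `x`, can return `s`.
For every cube `C ∈ C_G` that meets `[x, m]`, it computes a point `x' C` of `[x, m] ∩ C` nearest
to `x`; it selects such a cube `C'` for which `‖x - x' C'‖` is minimal and returns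
`[B_M(C')]^⋆(x' C')`. Ties may be broken in any way. -/
def AlgorithmReturns (m x : Pt d) (s : SignType) : Prop :=
  ∃ (x' : GridFace d n → Pt d) (C' : GridFace d n),
    (∀ C ∈ cubesOnSegment M b m x, x' C ∈ segment ℝ x m ∩ C.toSet ∧
      ∀ y ∈ segment ℝ x m ∩ C.toSet, ‖x - x' C‖ ≤ ‖x - y‖) ∧
    C' ∈ cubesOnSegment M b m x ∧
    (∀ C ∈ cubesOnSegment M b m x, ‖x - x' C'‖ ≤ ‖x - x' C‖) ∧
    IsCubeClass M b C' (x' C') s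

end

end Resistar

namespace Resistar

variable {d n : ℕ}

/-! Both classifications are read off from one process that refers neither to a chain of faces nor
to a component. Call a face cut if it carries boundary points. The barycentre of a cut face lies in
its relative interior (`bary_mem_relInt`), because the boundary points are interior to their edges
and do not all lie on one facet. A point of the relative interior of a cut face, other than the
barycentre, is pushed away from the barycentre to the relative boundary, and so on in smaller faces,
until it reaches an uncut face or starts from a barycentre. Relative interiors of distinct faces are
disjoint and a ray exits only once, so the outcome depends on the point alone (`RetractsTo.unique`).

The hulls in the definitions are iterated cones over barycentres, hence unions of such rays: the
resistar consists of the points that end at a barycentre, and off it the classification set of `D`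
consists of those that end in `D`. Uncut faces that meet share a vertex, so the uncut region splits
into two disjoint closed sides, and a component has the label of any of its points. Thus the class
in a cut cube (`isCubeClass_iff`) and the class on the grid (`isGridClass_iff`) both equal
`HasClass`; uniqueness and agreement between cubes follow.

For the algorithm, every cube met before the first point of a cut cube on the segment is uncut. The
segment up to that point, which is included by closedness, is a connected part of the uncut region,
so the class is constant on it (`hasClass_iff_of_nearest`). -/

theorem gridPoint_apply (v : Vtx d n) (j : Fin d) :
    gridPoint v j = ((v j : ℕ) : ℝ) * (1 / ((n : ℝ) - 1)) := rfl

theorem step_pos (hn : 2 ≤ n) : 0 < 1 / ((n : ℝ) - 1) := by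
  have : (2 : ℝ) ≤ n := by exact_mod_cast hn
  exact one_div_pos.2 (by linarith)

theorem gridPoint_le_iff (hn : 2 ≤ n) {v w : Vtx d n} {j k : Fin d} :
    gridPoint v j ≤ gridPoint w k ↔ v j ≤ w k := by
  rw [gridPoint_apply, gridPoint_apply, mul_le_mul_iff_left₀ (step_pos hn), Nat.cast_le]
  exact Fin.le_def.symm

theorem gridPoint_lt_iff (hn : 2 ≤ n) {v w : Vtx d n} {j k : Fin d} :
    gridPoint v j < gridPoint w k ↔ v j < w k := by
  rw [← not_le, gridPoint_le_iff hn, not_le]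

theorem gridPoint_eq_iff (hn : 2 ≤ n) {v w : Vtx d n} {j k : Fin d} :
    gridPoint v j = gridPoint w k ↔ v j = w k := by
  simp only [le_antisymm_iff, gridPoint_le_iff hn]

/-! ### Geometry of grid faces: subfaces, relative interiors and exit points of rays. -/

namespace GridFace

/-- `F` is a face of `F'`. -/
def IsSubface (F F' : GridFace d n) : Prop := ∀ j, F'.lo j ≤ F.lo j ∧ F.hi j ≤ F'.hi j

/-- The relative interior of a face. -/
def relInt (F : GridFace d n) : Set (Pt d) :=
  {x | x ∈ F.toSet ∧ ∀ j, F.lo j ≠ F.hi j → gridPoint F.lo j < x j ∧ x j < gridPoint F.hi j}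

theorem IsSubface.refl (F : GridFace d n) : F.IsSubface F := fun _ => ⟨le_rfl, le_rfl⟩

theorem IsSubface.trans {F F' F'' : GridFace d n} (h : F.IsSubface F') (h' : F'.IsSubface F'') :
    F.IsSubface F'' := fun j => ⟨(h' j).1.trans (h j).1, (h j).2.trans (h' j).2⟩

theorem IsSubface.antisymm {F F' : GridFace d n} (h : F.IsSubface F') (h' : F'.IsSubface F) :
    F = F' :=
  GridFace.ext (funext fun j => le_antisymm (h' j).1 (h j).1)
    (funext fun j => le_antisymm (h j).2 (h' j).2)

theorem gridPoint_lo_mem (hn : 2 ≤ n) (F : GridFace d n) : gridPoint F.lo ∈ F.toSet :=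
  fun j => ⟨le_rfl, (gridPoint_le_iff hn).2 (F.lo_le_hi j)⟩

theorem gridPoint_hi_mem (hn : 2 ≤ n) (F : GridFace d n) : gridPoint F.hi ∈ F.toSet :=
  fun j => ⟨(gridPoint_le_iff hn).2 (F.lo_le_hi j), le_rfl⟩

theorem subset_iff (hn : 2 ≤ n) {F F' : GridFace d n} : F.toSet ⊆ F'.toSet ↔ F.IsSubface F' := by
  constructor
  · intro h j
    exact ⟨(gridPoint_le_iff hn).1 (h (F.gridPoint_lo_mem hn) j).1,
      (gridPoint_le_iff hn).1 (h (F.gridPoint_hi_mem hn) j).2⟩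
  · intro h x hx j
    exact ⟨((gridPoint_le_iff hn).2 (h j).1).trans (hx j).1,
      (hx j).2.trans ((gridPoint_le_iff hn).2 (h j).2)⟩

theorem mem_verts_iff {F : GridFace d n} {v : Vtx d n} :
    v ∈ F.verts ↔ ∀ j, F.lo j ≤ v j ∧ v j ≤ F.hi j := by
  refine forall_congr' fun j => ?_
  have h1 := F.lo_le_hi j
  have h2 := F.hi_le_succ j
  simp only [Fin.le_def, Fin.ext_iff] at *
  omega

theorem gridPoint_mem_iff (hn : 2 ≤ n) {F : GridFace d n} {v : Vtx d n} :
    gridPoint v ∈ F.toSet ↔ v ∈ F.verts := by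
  rw [mem_verts_iff]
  exact forall_congr' fun j => and_congr (gridPoint_le_iff hn) (gridPoint_le_iff hn)

theorem lo_mem_verts (F : GridFace d n) : F.lo ∈ F.verts := fun _ => Or.inl rfl

theorem IsSubface.verts_subset {F F' : GridFace d n} (h : F.IsSubface F') :
    F.verts ⊆ F'.verts := by
  intro v hv
  rw [mem_verts_iff] at *
  exact fun j => ⟨(h j).1.trans (hv j).1, (hv j).2.trans (h j).2⟩

/-- The coordinatewise maximum of the two lowest vertices works: on each axis `x` lies above both
lower ends and below both upper ends. -/
theorem exists_common_vertex (hn : 2 ≤ n) {F F' : GridFace d n} {x : Pt d} (h : x ∈ F.toSet)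
    (h' : x ∈ F'.toSet) : ∃ v, v ∈ F.verts ∧ v ∈ F'.verts := by
  refine ⟨fun j => max (F.lo j) (F'.lo j), ?_, ?_⟩ <;> rw [mem_verts_iff] <;> intro j
  · exact ⟨le_max_left _ _, max_le (F.lo_le_hi j)
      ((gridPoint_le_iff hn).1 ((h' j).1.trans (h j).2))⟩
  · exact ⟨le_max_right _ _, max_le ((gridPoint_le_iff hn).1 ((h j).1.trans (h' j).2))
      (F'.lo_le_hi j)⟩

/-- A face that meets the relative interior of `F` contains `F`. -/
theorem isSubface_of_mem_relInt (hn : 2 ≤ n) {F F' : GridFace d n} {x : Pt d} (h : x ∈ F.relInt)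
    (h' : x ∈ F'.toSet) : F.IsSubface F' := by
  intro j
  by_cases hj : F.lo j = F.hi j
  · have h1 := h.1 j
    have h2 := h' j
    have h3 : gridPoint F.lo j = gridPoint F.hi j := (gridPoint_eq_iff hn).2 hj
    exact ⟨(gridPoint_le_iff hn).1 (by linarith), (gridPoint_le_iff hn).1 (by linarith)⟩
  · have h1 := h.2 j hj
    have h2 := h' j
    have h3 := (gridPoint_lt_iff hn).1 (h2.1.trans_lt h1.2)
    have h4 := (gridPoint_lt_iff hn).1 (h1.1.trans_le h2.2)
    -- The ends of `F` are adjacent on this axis, so an interval that reaches strictly below the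
    -- upper end and strictly above the lower end must contain both.
    have h5 := F.hi_le_succ j
    simp only [Fin.le_def, Fin.lt_def] at *
    omega

theorem IsSubface.dim_le {F F' : GridFace d n} (h : F.IsSubface F') : F.dim ≤ F'.dim := by
  refine Finset.card_le_card fun j => ?_
  have h1 := h j
  have h2 := F.lo_le_hi j
  simp only [Finset.mem_filter, Finset.mem_univ, true_and, Fin.le_def, ne_eq, Fin.ext_iff] at *
  omega

theorem notMem_relInt_of_dim_lt (hn : 2 ≤ n) {F F' : GridFace d n} (h : F.dim < F'.dim) {x : Pt d}
    (hx : x ∈ F.toSet) : x ∉ F'.relInt := fun hx' =>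
  absurd (isSubface_of_mem_relInt hn hx' hx).dim_le (not_le.2 h)

theorem convex_toSet (F : GridFace d n) : Convex ℝ F.toSet := by
  intro x hx y hy a c ha hc hac j
  simp only [PiLp.add_apply, PiLp.smul_apply, smul_eq_mul]
  have h1 := hx j
  have h2 := hy j
  obtain rfl : a = 1 - c := by linarith
  constructor <;> nlinarith

theorem isClosed_toSet (F : GridFace d n) : IsClosed F.toSet := by
  have : F.toSet = ⋂ j, {x : Pt d | gridPoint F.lo j ≤ x j ∧ x j ≤ gridPoint F.hi j} := by
    ext x; simp [toSet]
  rw [this]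
  refine isClosed_iInter fun j => ?_
  have hj : Continuous fun x : Pt d => x j := by fun_prop
  exact (isClosed_le continuous_const hj).inter (isClosed_le hj continuous_const)

/-- A box is a product of segments, and a product of hulls lies in the hull of the product. -/
theorem mem_convexHull_verts {F : GridFace d n} {x : Pt d} (hx : x ∈ F.toSet) :
    x ∈ convexHull ℝ (gridPoint '' F.verts) := by
  have h1 : (fun j => x j) ∈ convexHull ℝ
      (Set.univ.pi fun j => ({gridPoint F.lo j, gridPoint F.hi j} : Set ℝ)) := by
    refine mem_convexHull_pi fun j _ => ?_
    rw [convexHull_pair, segment_eq_Icc ((hx j).1.trans (hx j).2)]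
    exact hx j
  have h2 := Set.mem_image_of_mem (WithLp.linearEquiv 2 ℝ (Fin d → ℝ)).symm.toLinearMap h1
  rw [LinearMap.image_convexHull] at h2
  refine convexHull_mono ?_ h2
  rintro _ ⟨y, hy, rfl⟩
  choose v hv using fun j => show ∃ k, (k = F.lo j ∨ k = F.hi j) ∧
      y j = ((k : ℕ) : ℝ) * (1 / ((n : ℝ) - 1)) by
    rcases hy j (Set.mem_univ j) with h | h
    · exact ⟨_, Or.inl rfl, h⟩
    · exact ⟨_, Or.inr rfl, h⟩
  refine ⟨v, fun j => (hv j).1, ?_⟩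
  ext j
  exact ((hv j).2).symm

theorem convexHull_verts_subset (hn : 2 ≤ n) (F : GridFace d n) :
    convexHull ℝ (gridPoint '' F.verts) ⊆ F.toSet := by
  refine convexHull_min ?_ F.convex_toSet
  rintro _ ⟨v, hv, rfl⟩
  exact (gridPoint_mem_iff hn).2 hv

theorem combo_mem_relInt {F : GridFace d n} {c z : Pt d} (hc : c ∈ F.relInt) (hz : z ∈ F.toSet)
    {t : ℝ} (h0 : 0 < t) (h1 : t ≤ 1) : t • c + (1 - t) • z ∈ F.relInt := by
  refine ⟨F.convex_toSet hc.1 hz h0.le (by linarith) (by ring), fun j hj => ?_⟩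
  simp only [PiLp.add_apply, PiLp.smul_apply, smul_eq_mul]
  have h2 := hc.2 j hj
  have h3 := hz j
  constructor <;> nlinarith

/-- A ray from a point of the relative interior meets the relative boundary at most once. -/
theorem exit_unique {F : GridFace d n} {c z z' : Pt d} (hc : c ∈ F.relInt) (hz : z ∈ F.toSet)
    (hz' : z' ∈ F.toSet) (hzr : z ∉ F.relInt) (hzr' : z' ∉ F.relInt) {t t' : ℝ}
    (h1 : t < 1) (h1' : t' < 1)
    (h : t • c + (1 - t) • z = t' • c + (1 - t') • z') : z = z' := by
  wlog hle : t ≤ t' generalizing z z' t t'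
  · exact (this hz' hz hzr' hzr h1' h1 h.symm (le_of_not_ge hle)).symm
  have hpos : 0 < 1 - t := by linarith
  -- Solved for `z`, the hypothesis puts it between `c` and `z'`; a positive weight on `c` would
  -- place it in the relative interior.
  have key : z = ((t' - t) / (1 - t)) • c + (1 - (t' - t) / (1 - t)) • z' := by
    ext j
    have hj := congrArg (fun p : Pt d => p j) h
    simp only [PiLp.add_apply, PiLp.smul_apply, smul_eq_mul] at hj ⊢
    field_simp
    linarith
  rcases hle.eq_or_lt with rfl | hlt
  · simpa using key
  · exact absurd (key ▸ combo_mem_relInt hc hz' (div_pos (by linarith) hpos)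
      ((div_le_one hpos).2 (by linarith))) hzr

/-- The part of a face on which the coordinate `j` is `a`. -/
def facet (F : GridFace d n) (j : Fin d) (a : Fin n) (_ : a = F.lo j ∨ a = F.hi j) :
    GridFace d n where
  lo := Function.update F.lo j a
  hi := Function.update F.hi j a
  lo_le_hi k := by
    rcases eq_or_ne k j with rfl | hk
    · simp
    · simpa [hk] using F.lo_le_hi k
  hi_le_succ k := by
    rcases eq_or_ne k j with rfl | hk
    · simp
    · simpa [hk] using F.hi_le_succ k

section facet

variable {F : GridFace d n} {j : Fin d} {a : Fin n} {ha : a = F.lo j ∨ a = F.hi j}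

theorem facet_isSubface : (F.facet j a ha).IsSubface F := by
  intro k
  rcases eq_or_ne k j with rfl | hk
  · have := F.lo_le_hi k
    rcases ha with rfl | rfl <;> simp [facet, this]
  · simp [facet, hk]

theorem mem_facet_verts {v : Vtx d n} : v ∈ (F.facet j a ha).verts ↔ v ∈ F.verts ∧ v j = a := by
  constructor
  · intro h
    exact ⟨facet_isSubface.verts_subset h, by simpa [facet] using h j⟩
  · rintro ⟨h, h'⟩ k
    rcases eq_or_ne k j with rfl | hk
    · simp [facet, h']
    · simpa [facet, hk] using h k

theorem mem_facet {x : Pt d} (hx : x ∈ F.toSet) (h : ∃ v : Vtx d n, v j = a ∧ x j = gridPoint v j) :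
    x ∈ (F.facet j a ha).toSet := by
  obtain ⟨v, rfl, hv⟩ := h
  intro k
  rcases eq_or_ne k j with rfl | hk
  · simp [gridPoint_apply, facet, hv]
  · simpa [gridPoint_apply, facet, hk] using hx k

theorem dim_facet (hj : F.lo j ≠ F.hi j) : (F.facet j a ha).dim + 1 = F.dim := by
  have : Finset.univ.filter (fun k => F.lo k ≠ F.hi k) = insert j
      (Finset.univ.filter fun k => (F.facet j a ha).lo k ≠ (F.facet j a ha).hi k) := by
    ext k
    rw [Finset.mem_insert, Finset.mem_filter, Finset.mem_filter]
    rcases eq_or_ne k j with rfl | hk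
    · simpa using hj
    · simp [facet, hk]
  rw [dim, dim, this, Finset.card_insert_of_notMem]
  rw [Finset.mem_filter]
  simp [facet]

end facet

/-- A ray from a point of the relative interior leaves the face through one of its facets. -/
theorem exists_exit {F : GridFace d n} {c x : Pt d} (hc : c ∈ F.toSet) (hx : x ∈ F.toSet)
    (hne : x ≠ c) : ∃ F' : GridFace d n, F'.IsSubface F ∧ F'.dim + 1 = F.dim ∧
      ∃ z ∈ F'.toSet, ∃ t : ℝ, 0 ≤ t ∧ t < 1 ∧ x = t • c + (1 - t) • z := by
  classical
  -- `T j` is the parameter at which the ray from `c` through `x` reaches the bound of the box on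
  -- axis `j`; the exit facet belongs to the axis where it is least.
  let T : Fin d → ℝ := fun j => if c j < x j then (gridPoint F.hi j - c j) / (x j - c j)
    else (gridPoint F.lo j - c j) / (x j - c j)
  let S := Finset.univ.filter fun j => x j ≠ c j
  have hS : S.Nonempty := by
    by_contra h
    refine hne (PiLp.ext fun j => ?_)
    by_contra hj
    exact h ⟨j, by simp [S, hj]⟩
  have hT : ∀ j ∈ S, 1 ≤ T j := by
    intro j hj
    have h1 := hx j
    have h2 : x j ≠ c j := by simpa [S] using hj
    simp only [T]
    split_ifs with h
    · rw [one_le_div (by linarith)]; linarith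
    · have : x j < c j := lt_of_le_of_ne (not_lt.1 h) h2
      rw [one_le_div_of_neg (by linarith)]; linarith
  obtain ⟨j, hj, hmin⟩ := S.exists_min_image T hS
  have hT1 := hT j hj
  have hxj : x j ≠ c j := by simpa [S] using hj
  have hfree : F.lo j ≠ F.hi j := by
    intro h
    have h1 := hx j
    have h2 := hc j
    have h3 : gridPoint F.lo j = gridPoint F.hi j := by rw [gridPoint_apply, h]; rfl
    exact hxj (by linarith)
  let z : Pt d := c + T j • (x - c)
  have hz : z ∈ F.toSet := by
    intro k
    have h1 := hx k
    have h2 := hc k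
    simp only [z, PiLp.add_apply, PiLp.smul_apply, PiLp.sub_apply, smul_eq_mul]
    rcases lt_trichotomy (c k) (x k) with h | h | h
    · have h3 := hmin k (by simp [S, h.ne'])
      have h4 : T k = (gridPoint F.hi k - c k) / (x k - c k) := if_pos h
      rw [h4, le_div_iff₀ (by linarith)] at h3
      constructor <;> nlinarith
    · rw [h, sub_self, mul_zero, add_zero]; exact h1
    · have h3 := hmin k (by simp [S, h.ne])
      have h4 : T k = (gridPoint F.lo k - c k) / (x k - c k) := if_neg h.le.not_gt
      rw [h4, le_div_iff_of_neg (by linarith)] at h3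
      constructor <;> nlinarith
  have hx' : x = (1 - 1 / T j) • c + (1 - (1 - 1 / T j)) • z := by
    have : T j ≠ 0 := by linarith
    ext k
    simp only [z, PiLp.add_apply, PiLp.smul_apply, PiLp.sub_apply, smul_eq_mul]
    field_simp
    ring
  have ht0 : 0 ≤ 1 - 1 / T j := by
    rw [sub_nonneg, div_le_one (by linarith)]; exact hT1
  have ht1 : 1 - 1 / T j < 1 := by
    have : 0 < 1 / T j := one_div_pos.2 (by linarith)
    linarith
  have hzj : z j = gridPoint F.hi j ∨ z j = gridPoint F.lo j := by
    have h0 : x j - c j ≠ 0 := sub_ne_zero.2 hxj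
    simp only [z, PiLp.add_apply, PiLp.smul_apply, PiLp.sub_apply, smul_eq_mul, T]
    split_ifs
    · left; field_simp; ring
    · right; field_simp; ring
  rcases hzj with h | h
  · exact ⟨F.facet j (F.hi j) (Or.inr rfl), facet_isSubface, dim_facet hfree, z,
      mem_facet hz ⟨F.hi, rfl, h⟩, _, ht0, ht1, hx'⟩
  · exact ⟨F.facet j (F.lo j) (Or.inl rfl), facet_isSubface, dim_facet hfree, z,
      mem_facet hz ⟨F.lo, rfl, h⟩, _, ht0, ht1, hx'⟩

theorem exists_cube_of_mem_unitCube (hn : 2 ≤ n) {x : Pt d} (hx : x ∈ unitCube d) :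
    ∃ C : GridFace d n, C.dim = d ∧ x ∈ C.toSet := by
  have hs := step_pos hn
  have hn' : (0 : ℝ) < (n : ℝ) - 1 := one_div_pos.1 hs
  have key : ∀ j, ∃ k : ℕ, k + 1 < n ∧ (k : ℝ) * (1 / ((n : ℝ) - 1)) ≤ x j ∧
      x j ≤ ((k + 1 : ℕ) : ℝ) * (1 / ((n : ℝ) - 1)) := by
    intro j
    obtain ⟨h0, h1⟩ := hx j
    simp only [mul_one_div, div_le_iff₀ hn', le_div_iff₀ hn']
    have h2 : 0 ≤ x j * (n - 1) := mul_nonneg h0 hn'.le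
    -- At the right end the floor would give `n - 1`, one past the last cell.
    by_cases h : x j = 1
    · refine ⟨n - 2, by omega, ?_, ?_⟩
      · rw [h, Nat.cast_sub hn]; push_cast; linarith
      · rw [h, show n - 2 + 1 = n - 1 by omega, Nat.cast_sub (by omega)]; push_cast; linarith
    · refine ⟨⌊x j * (n - 1)⌋₊, ?_, Nat.floor_le h2, ?_⟩
      · have h3 : x j * (n - 1) < n - 1 := by
          have := lt_of_le_of_ne h1 h
          nlinarith
        have h4 : ((⌊x j * (n - 1)⌋₊ : ℕ) : ℝ) + 1 < n := by linarith [Nat.floor_le h2]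
        exact_mod_cast h4
      · push_cast; exact (Nat.lt_floor_add_one _).le
  choose k hk using key
  refine ⟨⟨fun j => ⟨k j, by have := (hk j).1; omega⟩, fun j => ⟨k j + 1, (hk j).1⟩,
    fun j => by simp [Fin.le_def], fun j => le_rfl⟩, ?_, fun j => (hk j).2⟩
  simp [dim, Fin.ext_iff]

theorem toSet_subset_unitCube (hn : 2 ≤ n) (F : GridFace d n) : F.toSet ⊆ unitCube d := by
  intro x hx j
  have hs := step_pos hn
  have hn' : (0 : ℝ) < (n : ℝ) - 1 := one_div_pos.1 hs
  refine ⟨le_trans ?_ (hx j).1, (hx j).2.trans ?_⟩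
  · rw [gridPoint_apply]; positivity
  · rw [gridPoint_apply, mul_one_div, div_le_one hn']
    have h : ((F.hi j : ℕ) : ℝ) + 1 ≤ n := by exact_mod_cast (F.hi j).isLt
    linarith

theorem centre_mem (hn : 2 ≤ n) (F : GridFace d n) : F.centre ∈ F.toSet :=
  F.convex_toSet.midpoint_mem (F.gridPoint_lo_mem hn) (F.gridPoint_hi_mem hn)

end GridFace

theorem convex_unitCube : Convex ℝ (unitCube d) := by
  intro x hx y hy a c ha hc hac j
  simp only [PiLp.add_apply, PiLp.smul_apply, smul_eq_mul]
  have h1 := hx j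
  have h2 := hy j
  obtain rfl : a = 1 - c := by linarith
  constructor <;> nlinarith

/-! ### Cut faces and the position of their barycentres. -/

section Barycentre

open GridFace

variable {M : Pt d → SignType} {b : Vtx d n → Vtx d n → Pt d}

theorem mem_boundaryPoints {F : GridFace d n} {p : Pt d} : p ∈ boundaryPoints M b F ↔
    ∃ u w, IsCutEdge M u w ∧ u ∈ F.verts ∧ w ∈ F.verts ∧ b u w = p := by
  simp [boundaryPoints, and_assoc]

theorem boundaryPoints_mono {F F' : GridFace d n} (h : F.IsSubface F') :
    boundaryPoints M b F ⊆ boundaryPoints M b F' := by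
  intro p hp
  rw [mem_boundaryPoints] at *
  obtain ⟨u, w, h1, h2, h3, h4⟩ := hp
  exact ⟨u, w, h1, h.verts_subset h2, h.verts_subset h3, h4⟩

theorem IsEdge.symm {u w : Vtx d n} (h : IsEdge u w) : IsEdge w u := by
  obtain ⟨j, h1, h2⟩ := h
  exact ⟨j, h1.symm, fun k hk => (h2 k hk).symm⟩

theorem isCutEdge_or_of_ne (hM : ∀ v : Vtx d n, M (gridPoint v) ≠ 0) {u w : Vtx d n}
    (h : IsEdge u w) (hne : M (gridPoint u) ≠ M (gridPoint w)) :
    IsCutEdge M u w ∨ IsCutEdge M w u := by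
  have h1 := hM u
  have h2 := hM w
  unfold IsCutEdge
  rcases hu : M (gridPoint u) with _ | _ | _ <;> rcases hw : M (gridPoint w) with _ | _ | _ <;>
    (simp_all; try simp_all [h.symm])

/-- The vertices of a face without boundary points all lie on the same side. -/
theorem boundaryPoints_eq_empty_iff (hM : ∀ v : Vtx d n, M (gridPoint v) ≠ 0)
    {F : GridFace d n} : boundaryPoints M b F = ∅ ↔
      ∀ v ∈ F.verts, M (gridPoint v) = M (gridPoint F.lo) := by
  classical
  constructor
  · intro h v hv
    -- Coordinates are changed from `F.lo` to `v` one at a time; each actual change follows an edge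
    -- of `F`, which is not cut.
    have key : ∀ S : Finset (Fin d), M (gridPoint (S.piecewise v F.lo)) = M (gridPoint F.lo) := by
      intro S
      induction S using Finset.induction_on with
      | empty => simp
      | insert j S hj ih =>
        rw [← ih]
        by_contra hne
        have hmem : ∀ S : Finset (Fin d), S.piecewise v F.lo ∈ F.verts := by
          intro S k
          by_cases hk : k ∈ S
          · simpa [hk] using hv k
          · simp [hk]
        have hvj : v j ≠ F.lo j := by
          intro h'
          apply hne
          rw [Finset.piecewise_insert, h', Function.update_eq_self_iff.2]
          simp [hj]
        have hedge : IsEdge ((insert j S).piecewise v F.lo) (S.piecewise v F.lo) := by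
          refine ⟨j, Or.inr ?_, fun k hk => by simp [Finset.piecewise, hk]⟩
          have h1 := F.hi_le_succ j
          have h2 := F.lo_le_hi j
          have h3 := hv j
          rw [Finset.piecewise_eq_of_mem _ _ _ (Finset.mem_insert_self j S),
            Finset.piecewise_eq_of_notMem _ _ _ hj]
          simp only [Fin.le_def, Fin.ext_iff, ne_eq] at *
          omega
        rcases isCutEdge_or_of_ne hM hedge hne with h' | h'
        · exact Finset.notMem_empty _ (h ▸ mem_boundaryPoints.2 ⟨_, _, h', hmem _, hmem _, rfl⟩)
        · exact Finset.notMem_empty _ (h ▸ mem_boundaryPoints.2 ⟨_, _, h', hmem _, hmem _, rfl⟩)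
    simpa using key Finset.univ
  · intro h
    rw [Finset.eq_empty_iff_forall_notMem]
    intro p hp
    obtain ⟨u, w, h1, h2, h3, -⟩ := mem_boundaryPoints.1 hp
    have := (h u h2).trans (h w h3).symm
    rw [h1.2.1, h1.2.2] at this
    exact absurd this (by decide)

variable {ne : ℕ}

/-- The half step keeps the point off both ends of the edge, even when `i` is `0` or `ne - 1`. -/
theorem boundaryPoint_eq_lineMap (hb : IsBoundaryPointChoice M ne b) {u w : Vtx d n}
    (h : IsCutEdge M u w) : ∃ t : ℝ, 0 < t ∧ t < 1 ∧
      b u w = gridPoint u + t • (gridPoint w - gridPoint u) := by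
  obtain ⟨i, hi, -, -, hb'⟩ := hb u w h
  have h1 : ((i : ℕ) : ℝ) + 1 ≤ ne := by exact_mod_cast hi
  have h2 : (0 : ℝ) ≤ i := Nat.cast_nonneg i
  exact ⟨_, div_pos (by linarith) (by linarith), (div_lt_one (by linarith)).2 (by linarith), hb'⟩

theorem boundaryPoints_subset (hn : 2 ≤ n) (hb : IsBoundaryPointChoice M ne b)
    {F : GridFace d n} {p : Pt d} (hp : p ∈ boundaryPoints M b F) : p ∈ F.toSet := by
  obtain ⟨u, w, h, hu, hw, rfl⟩ := mem_boundaryPoints.1 hp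
  obtain ⟨t, h0, h1, h2⟩ := boundaryPoint_eq_lineMap hb h
  rw [h2]
  exact F.convex_toSet.add_smul_sub_mem ((gridPoint_mem_iff hn).2 hu)
    ((gridPoint_mem_iff hn).2 hw) ⟨h0.le, h1.le⟩

/-- A boundary point has an integral coordinate only along axes transverse to its edge. -/
theorem eq_of_boundaryPoint_apply_eq (hn : 2 ≤ n) (hb : IsBoundaryPointChoice M ne b)
    {u w v : Vtx d n} (h : IsCutEdge M u w) {j : Fin d} (hj : b u w j = gridPoint v j) :
    u j = v j ∧ w j = v j := by
  obtain ⟨t, h0, h1, h2⟩ := boundaryPoint_eq_lineMap hb h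
  rw [h2] at hj
  simp only [PiLp.add_apply, PiLp.smul_apply, PiLp.sub_apply, smul_eq_mul, gridPoint_apply] at hj
  have hs := step_pos hn
  have hj' : ((u j : ℕ) : ℝ) + t * ((w j : ℕ) - (u j : ℕ)) = (v j : ℕ) := by
    apply mul_right_cancel₀ hs.ne'
    linarith
  obtain ⟨k, hk, hk'⟩ := h.1
  rcases eq_or_ne j k with rfl | hjk
  · exfalso
    rcases hk with hk | hk
    · have hk1 : ((w j : ℕ) : ℝ) = (u j : ℕ) + 1 := by exact_mod_cast hk.symm
      rw [hk1] at hj'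
      have h3 : ((u j : ℕ) : ℝ) < (v j : ℕ) := by linarith
      have h4 : ((v j : ℕ) : ℝ) < ((u j : ℕ) + 1 : ℕ) := by push_cast; linarith
      rw [Nat.cast_lt] at h3 h4
      omega
    · have hk1 : ((u j : ℕ) : ℝ) = (w j : ℕ) + 1 := by exact_mod_cast hk.symm
      rw [hk1] at hj'
      have h3 : ((w j : ℕ) : ℝ) < (v j : ℕ) := by linarith
      have h4 : ((v j : ℕ) : ℝ) < ((w j : ℕ) + 1 : ℕ) := by push_cast; linarith
      rw [Nat.cast_lt] at h3 h4
      omega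
  · have huw := hk' j hjk
    rw [← huw, sub_self, mul_zero, add_zero, Nat.cast_inj] at hj'
    exact ⟨Fin.ext hj', huw ▸ Fin.ext hj'⟩

/-- The boundary points of a face do not all lie on one of its facets. -/
theorem exists_boundaryPoint_apply_ne (hn : 2 ≤ n) (hM : ∀ v : Vtx d n, M (gridPoint v) ≠ 0)
    (hb : IsBoundaryPointChoice M ne b) {F : GridFace d n} (hF : (boundaryPoints M b F).Nonempty)
    {j : Fin d} {v v' : Vtx d n} (hv : v j = F.lo j ∧ v' j = F.hi j ∨ v j = F.hi j ∧ v' j = F.lo j)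
    (hfree : F.lo j ≠ F.hi j) : ∃ p ∈ boundaryPoints M b F, p j ≠ gridPoint v j := by
  by_contra! hall
  have hvv : v j ≠ v' j := by
    rcases hv with ⟨h, h'⟩ | ⟨h, h'⟩ <;> rw [h, h']
    exacts [hfree, hfree.symm]
  have ha : v' j = F.lo j ∨ v' j = F.hi j := by
    rcases hv with ⟨h, h'⟩ | ⟨h, h'⟩ <;> rw [h'] <;> simp
  have hcut : ∀ u w, IsCutEdge M u w → u ∈ F.verts → w ∈ F.verts → u j = v j ∧ w j = v j :=
    fun u w h hu hw => eq_of_boundaryPoint_apply_eq hn hb h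
      (hall _ (mem_boundaryPoints.2 ⟨u, w, h, hu, hw, rfl⟩))
  -- If all boundary points lie on one facet, the opposite facet is uncut, and so are the edges that
  -- join the two facets. All vertices then have the same label, which contradicts `hF`.
  have hfacet : boundaryPoints M b (F.facet j (v' j) ha) = ∅ := by
    rw [Finset.eq_empty_iff_forall_notMem]
    intro p hp
    obtain ⟨u, w, h, hu, hw, -⟩ := mem_boundaryPoints.1 hp
    rw [mem_facet_verts] at hu hw
    exact hvv ((hcut u w h hu.1 hw.1).1.symm.trans hu.2)
  rw [boundaryPoints_eq_empty_iff hM] at hfacet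
  have hconst : ∀ u ∈ F.verts, M (gridPoint u) =
      M (gridPoint (F.facet j (v' j) ha).lo) := by
    intro u hu
    by_cases huj : u j = v' j
    · exact hfacet u (mem_facet_verts.2 ⟨hu, huj⟩)
    · have hu' : Function.update u j (v' j) ∈ F.verts := by
        intro k
        rcases eq_or_ne k j with rfl | hk
        · simpa using ha
        · simpa [hk] using hu k
      rw [← hfacet _ (mem_facet_verts.2 ⟨hu', by simp⟩)]
      by_contra hne
      have hedge : IsEdge u (Function.update u j (v' j)) := by
        refine ⟨j, ?_, fun k hk => by simp [hk]⟩
        have h1 := F.hi_le_succ j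
        have h2 := F.lo_le_hi j
        have h3 := hu j
        simp only [Function.update_self, Fin.le_def, Fin.ext_iff] at *
        omega
      rcases isCutEdge_or_of_ne hM hedge hne with h | h
      · exact hvv (by simpa using (hcut _ _ h hu hu').2.symm)
      · exact hvv (by simpa using (hcut _ _ h hu' hu).1.symm)
  refine hF.ne_empty ((boundaryPoints_eq_empty_iff hM).2 fun u hu => ?_)
  rw [hconst u hu, hconst _ F.lo_mem_verts]

theorem bary_apply (F : GridFace d n) (j : Fin d) : bary M b F j =
    ((boundaryPoints M b F).card : ℝ)⁻¹ * ∑ p ∈ boundaryPoints M b F, p j := by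
  simp [bary]

/-- The barycentre of the boundary points of a face lies in its relative interior. -/
theorem bary_mem_relInt (hn : 2 ≤ n) (hM : ∀ v : Vtx d n, M (gridPoint v) ≠ 0)
    (hb : IsBoundaryPointChoice M ne b) {F : GridFace d n}
    (hF : (boundaryPoints M b F).Nonempty) : bary M b F ∈ F.relInt := by
  have hcard : (0 : ℝ) < (boundaryPoints M b F).card := by exact_mod_cast hF.card_pos
  have hmem := fun p hp => boundaryPoints_subset (F := F) (p := p) hn hb hp
  have hsum : ∀ a : ℝ, a * (boundaryPoints M b F).card = ∑ _p ∈ boundaryPoints M b F, a := by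
    intro a
    rw [Finset.sum_const, nsmul_eq_mul, mul_comm]
  refine ⟨fun j => ?_, fun j hj => ?_⟩
  · rw [bary_apply, inv_mul_eq_div, le_div_iff₀ hcard, div_le_iff₀ hcard, hsum, hsum]
    exact ⟨Finset.sum_le_sum fun p hp => (hmem p hp j).1,
      Finset.sum_le_sum fun p hp => (hmem p hp j).2⟩
  · rw [bary_apply, inv_mul_eq_div, lt_div_iff₀ hcard, div_lt_iff₀ hcard, hsum, hsum]
    constructor
    · obtain ⟨p, hp, hne⟩ := exists_boundaryPoint_apply_ne hn hM hb hF
        (v := F.lo) (v' := F.hi) (Or.inl ⟨rfl, rfl⟩) hj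
      exact Finset.sum_lt_sum (fun p hp => (hmem p hp j).1)
        ⟨p, hp, lt_of_le_of_ne (hmem p hp j).1 hne.symm⟩
    · obtain ⟨p, hp, hne⟩ := exists_boundaryPoint_apply_ne hn hM hb hF
        (v := F.hi) (v' := F.lo) (Or.inr ⟨rfl, rfl⟩) hj
      exact Finset.sum_lt_sum (fun p hp => (hmem p hp j).2)
        ⟨p, hp, lt_of_le_of_ne (hmem p hp j).2 hne⟩

end Barycentre

/-! ### The retraction along rays from barycentres, and its description by flags of faces. -/

section Retraction

open GridFace

/-- The retraction onto the faces without boundary points, along the rays from the barycentres: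
`RetractsTo M b x (some y)` if `x` is moved to `y`, and `RetractsTo M b x none` if `x` is moved to a
barycentre of boundary points. -/
inductive RetractsTo (M : Pt d → SignType) (b : Vtx d n → Vtx d n → Pt d) :
    Pt d → Option (Pt d) → Prop
  | pure (F : GridFace d n) (x : Pt d) (hF : boundaryPoints M b F = ∅) (hx : x ∈ F.toSet) :
      RetractsTo M b x (some x)
  | apex (F : GridFace d n) (hF : (boundaryPoints M b F).Nonempty) :
      RetractsTo M b (bary M b F) none
  | cone (F : GridFace d n) (z : Pt d) (t : ℝ) (r : Option (Pt d))
      (hF : (boundaryPoints M b F).Nonempty) (hz : z ∈ F.toSet) (hz' : z ∉ F.relInt)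
      (h0 : 0 < t) (h1 : t < 1) (h : RetractsTo M b z r) :
      RetractsTo M b (t • bary M b F + (1 - t) • z) r

/-- A sequence of faces, the `i`-th one of dimension `i`, each in the next one, for indices between
`h` and `k`. -/
def IsFlag (h k : ℕ) (F : ℕ → GridFace d n) : Prop :=
  (∀ i, h ≤ i → i ≤ k → (F i).dim = i) ∧ ∀ i, h ≤ i → i < k → (F i).IsSubface (F (i + 1))

theorem isFaceChain_iff (hn : 2 ≤ n) {C : GridFace d n} {h : ℕ} {F : ℕ → GridFace d n} :
    IsFaceChain C h F ↔ F d = C ∧ IsFlag h d F := by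
  simp only [IsFaceChain, IsFlag, subset_iff hn]

theorem IsFlag.isSubface {h k : ℕ} {F : ℕ → GridFace d n} (hF : IsFlag h k F) {i j : ℕ}
    (hi : h ≤ i) (hij : i ≤ j) (hj : j ≤ k) : (F i).IsSubface (F j) := by
  induction j, hij using Nat.le_induction with
  | base => exact IsSubface.refl _
  | succ j hij ih => exact (ih (by omega)).trans (hF.2 j (by omega) (by omega))

theorem IsFlag.append {h k : ℕ} {F : ℕ → GridFace d n} (hF : IsFlag h k F) {C : GridFace d n}
    (hsub : (F k).IsSubface C) (hdim : C.dim = k + 1) :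
    IsFlag h (k + 1) (Function.update F (k + 1) C) := by
  constructor
  · intro i hi hik
    rcases eq_or_ne i (k + 1) with rfl | hne
    · simpa using hdim
    · simpa [hne] using hF.1 i hi (by omega)
  · intro i hi hik
    rw [Function.update_of_ne (by omega)]
    rcases eq_or_ne i k with rfl | hne
    · simpa using hsub
    · simpa [hne] using hF.2 i hi (by omega)

variable {M : Pt d → SignType} {b : Vtx d n → Vtx d n → Pt d} {ne : ℕ}

theorem combo_mem_convexHull_append {S : Set (Pt d)} {a k : ℕ} (hak : a ≤ k + 1)
    {F : ℕ → GridFace d n} (C : GridFace d n) {z : Pt d}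
    (hz : z ∈ convexHull ℝ (S ∪ (fun i => bary M b (F i)) '' Set.Icc a k)) {t : ℝ}
    (h0 : 0 ≤ t) (h1 : t ≤ 1) : t • bary M b C + (1 - t) • z ∈
      convexHull ℝ (S ∪ (fun i => bary M b (Function.update F (k + 1) C i)) ''
        Set.Icc a (k + 1)) := by
  have hsub : S ∪ (fun i => bary M b (F i)) '' Set.Icc a k ⊆
      S ∪ (fun i => bary M b (Function.update F (k + 1) C i)) '' Set.Icc a (k + 1) := by
    refine Set.union_subset_union_right _ ?_
    rintro _ ⟨i, hi, rfl⟩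
    refine ⟨i, ⟨hi.1, hi.2.trans (Nat.le_succ k)⟩, ?_⟩
    simp [show i ≠ k + 1 by have := hi.2; omega]
  have hC : bary M b C ∈
      S ∪ (fun i => bary M b (Function.update F (k + 1) C i)) '' Set.Icc a (k + 1) :=
    Or.inr ⟨k + 1, ⟨hak, le_rfl⟩, by simp⟩
  exact convex_convexHull ℝ _ (subset_convexHull ℝ _ hC) (convexHull_mono hsub hz) h0
    (sub_nonneg.2 h1) (add_sub_cancel t 1)

theorem boundaryPoints_eq_empty_of_isSubface {F F' : GridFace d n} (h : F.IsSubface F')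
    (h' : boundaryPoints M b F' = ∅) : boundaryPoints M b F = ∅ :=
  Finset.subset_empty.1 (h' ▸ boundaryPoints_mono h)

theorem notMem_of_mem_relInt (hn : 2 ≤ n) {F F' : GridFace d n}
    (hF : (boundaryPoints M b F).Nonempty) (hF' : boundaryPoints M b F' = ∅) {x : Pt d}
    (hx : x ∈ F.relInt) : x ∉ F'.toSet := fun hx' =>
  hF.ne_empty (boundaryPoints_eq_empty_of_isSubface (isSubface_of_mem_relInt hn hx hx') hF')

theorem eq_of_mem_relInt (hn : 2 ≤ n) {F F' : GridFace d n} {x : Pt d} (hx : x ∈ F.relInt)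
    (hx' : x ∈ F'.relInt) : F = F' :=
  (isSubface_of_mem_relInt hn hx hx'.1).antisymm (isSubface_of_mem_relInt hn hx' hx.1)

/-- A point is either in an uncut face or in the relative interior of exactly one cut face. In the
latter case `exit_unique` determines the exit point, from which the induction continues. -/
theorem RetractsTo.unique (hn : 2 ≤ n) (hM : ∀ v : Vtx d n, M (gridPoint v) ≠ 0)
    (hb : IsBoundaryPointChoice M ne b) {x : Pt d} {r r' : Option (Pt d)}
    (h : RetractsTo M b x r) (h' : RetractsTo M b x r') : r = r' := by
  have hbary := fun F hF => bary_mem_relInt (F := F) hn hM hb hF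
  -- Case analysis with the point as a variable: the constructors pin it to expressions that do not
  -- unify when two derivations are compared.
  have key : ∀ {x r}, RetractsTo M b x r →
      (∃ F : GridFace d n, boundaryPoints M b F = ∅ ∧ x ∈ F.toSet ∧ r = some x) ∨
      ∃ F : GridFace d n, (boundaryPoints M b F).Nonempty ∧ x ∈ F.relInt ∧
        (x = bary M b F ∧ r = none ∨
          ∃ (z : Pt d) (t : ℝ), z ∈ F.toSet ∧ z ∉ F.relInt ∧ 0 < t ∧ t < 1 ∧
          x = t • bary M b F + (1 - t) • z ∧ RetractsTo M b z r) := by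
    rintro x r (⟨F, _, hF, hx⟩ | ⟨F, hF⟩ | ⟨F, z, t, _, hF, hz, hz', h0, h1, h⟩)
    · exact Or.inl ⟨F, hF, hx, rfl⟩
    · exact Or.inr ⟨F, hF, hbary F hF, Or.inl ⟨rfl, rfl⟩⟩
    · exact Or.inr ⟨F, hF, combo_mem_relInt (hbary F hF) hz h0 h1.le,
        Or.inr ⟨z, t, hz, hz', h0, h1, rfl, h⟩⟩
  induction h generalizing r' with
  | pure F x hF hx =>
    rcases key h' with ⟨_, -, -, rfl⟩ | ⟨F', hF', hx', -⟩
    · rfl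
    · exact absurd hx (notMem_of_mem_relInt hn hF' hF hx')
  | apex F hF =>
    rcases key h' with ⟨F', hF', hx', rfl⟩ | ⟨F', hF', hx', h⟩
    · exact absurd hx' (notMem_of_mem_relInt hn hF hF' (hbary F hF))
    · obtain rfl := eq_of_mem_relInt hn (hbary F hF) hx'
      rcases h with ⟨-, rfl⟩ | ⟨z, t, hz, hz', h0, h1, he, -⟩
      · rfl
      · have : z = bary M b F := by
          have h2 : (1 - t) • z = (1 - t) • bary M b F := by
            rw [sub_smul 1 t (bary M b F), one_smul]
            exact eq_sub_of_add_eq' he.symm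
          exact smul_right_injective _ (sub_ne_zero.2 h1.ne') h2
        exact absurd (this ▸ hx') hz'
  | cone F z t r hF hz hz' h0 h1 h ih =>
    have hx := combo_mem_relInt (hbary F hF) hz h0 h1.le
    rcases key h' with ⟨F', hF', hx', rfl⟩ | ⟨F', hF', hx', h⟩
    · exact absurd hx' (notMem_of_mem_relInt hn hF hF' hx)
    · obtain rfl := eq_of_mem_relInt hn hx hx'
      rcases h with ⟨he, -⟩ | ⟨z', t', hz1, hz1', h0', h1', he, h''⟩
      · have : z = bary M b F := by
          have h2 : (1 - t) • z = (1 - t) • bary M b F := by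
            rw [sub_smul 1 t (bary M b F), one_smul]
            exact eq_sub_of_add_eq' he
          exact smul_right_injective _ (sub_ne_zero.2 h1.ne') h2
        exact absurd (this ▸ hbary F hF) hz'
      · obtain rfl := exit_unique (hbary F hF) hz hz1 hz' hz1' h1 h1' he
        exact ih h''

/-- Adding the barycentre of the next face makes a cone over the previous hull, which lies in a face
of smaller dimension and so misses the new relative interior. Each generating segment is therefore a
retraction ray; its apex is why `none` must be allowed. The base `S` is a single barycentre for
resistars and the vertices of an uncut face for classification sets. -/
theorem exists_retractsTo_of_mem_convexHull (hn : 2 ≤ n) (hM : ∀ v : Vtx d n, M (gridPoint v) ≠ 0)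
    (hb : IsBoundaryPointChoice M ne b) {h k : ℕ} (hhk : h ≤ k) {F : ℕ → GridFace d n}
    (hF : IsFlag h k F) (hmixed : ∀ i, h < i → i ≤ k → (boundaryPoints M b (F i)).Nonempty)
    {S : Set (Pt d)} (hSne : S.Nonempty) (hSF : S ⊆ (F h).toSet) {R : Set (Option (Pt d))}
    (hnone : none ∈ R) (hS : ∀ x ∈ convexHull ℝ S, ∃ r ∈ R, RetractsTo M b x r) {x : Pt d}
    (hx : x ∈ convexHull ℝ (S ∪ (fun i => bary M b (F i)) '' Set.Icc (h + 1) k)) :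
    x ∈ (F k).toSet ∧ ∃ r ∈ R, RetractsTo M b x r := by
  induction k, hhk using Nat.le_induction generalizing x with
  | base =>
    rw [Set.Icc_eq_empty (by omega), Set.image_empty, Set.union_empty] at hx
    exact ⟨convexHull_min hSF (convex_toSet _) hx, hS x hx⟩
  | succ k hhk ih =>
    have hIcc : Set.Icc (h + 1) (k + 1) = insert (k + 1) (Set.Icc (h + 1) k) := by
      ext i; simp only [Set.mem_Icc, Set.mem_insert_iff]; omega
    rw [hIcc, Set.image_insert_eq, Set.union_insert, convexHull_insert hSne.inl,
      mem_convexJoin] at hx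
    obtain ⟨c, rfl, z, hz, t, t', ht, ht', htt, rfl⟩ := hx
    obtain ⟨hzF, r, hr, hzr⟩ := ih ⟨fun i hi hi' => hF.1 i hi (by omega),
      fun i hi hi' => hF.2 i hi (by omega)⟩ (fun i hi hi' => hmixed i hi (by omega)) hz
    have hm := hmixed (k + 1) (by omega) le_rfl
    have hzF' : z ∈ (F (k + 1)).toSet := (subset_iff hn).2 (hF.2 k hhk (by omega)) hzF
    obtain rfl : t' = 1 - t := by linarith
    refine ⟨convex_toSet _ (bary_mem_relInt hn hM hb hm).1 hzF' ht ht' htt, ?_⟩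
    rcases ht.eq_or_lt with rfl | h0
    · exact ⟨r, hr, by simpa using hzr⟩
    rcases (show t ≤ 1 by linarith).eq_or_lt with rfl | h1
    · exact ⟨none, hnone, by simpa using RetractsTo.apex _ hm⟩
    · refine ⟨r, hr, RetractsTo.cone _ z t r hm hzF' ?_ h0 h1 hzr⟩
      refine notMem_relInt_of_dim_lt hn ?_ hzF
      rw [hF.1 k hhk (by omega), hF.1 (k + 1) (by omega) le_rfl]
      exact Nat.lt_succ_self k

theorem IsFlag.nonempty {h k : ℕ} {F : ℕ → GridFace d n} (hF : IsFlag h k F) {j : ℕ} (hj : h ≤ j)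
    (hne : (boundaryPoints M b (F j)).Nonempty) {i : ℕ} (hji : j ≤ i) (hi : i ≤ k) :
    (boundaryPoints M b (F i)).Nonempty :=
  hne.mono (boundaryPoints_mono (hF.isSubface hj hji hi))

/-- One cut edge is kept while the face shrinks to facets that contain it. -/
theorem exists_flag {k : ℕ} {C : GridFace d n} (hdim : C.dim = k)
    (hC : (boundaryPoints M b C).Nonempty) :
    1 ≤ k ∧ ∃ F, F k = C ∧ IsFlag 1 k F ∧ (boundaryPoints M b (F 1)).Nonempty := by
  induction k generalizing C with
  | zero =>
    obtain ⟨p, hp⟩ := hC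
    obtain ⟨u, w, h, hu, hw, -⟩ := mem_boundaryPoints.1 hp
    obtain ⟨j, hj, -⟩ := h.1
    have hfree : C.lo j = C.hi j := by
      by_contra hne
      have : j ∈ Finset.univ.filter (fun j => C.lo j ≠ C.hi j) := by simp [hne]
      rw [Finset.card_eq_zero.1 hdim] at this
      simp at this
    have h1 := hu j
    have h2 := hw j
    simp only [hfree, or_self] at h1 h2
    rw [h1, h2] at hj
    omega
  | succ k ih =>
    refine ⟨by omega, ?_⟩
    rcases Nat.eq_zero_or_pos k with rfl | hk
    · exact ⟨fun _ => C, rfl, ⟨fun i h h' => by rw [hdim]; omega, fun i h h' => by omega⟩, hC⟩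
    obtain ⟨p, hp⟩ := hC
    obtain ⟨u, w, h, hu, hw, hpb⟩ := mem_boundaryPoints.1 hp
    obtain ⟨j, -, hj⟩ := h.1
    -- In dimension at least two there is a free axis other than that of the edge; fixing it retains
    -- both endpoints.
    obtain ⟨i, hi, hij⟩ := Finset.exists_mem_ne (s := Finset.univ.filter
      (fun j => C.lo j ≠ C.hi j)) (lt_of_lt_of_eq (by omega) hdim.symm) j
    have hi' : C.lo i ≠ C.hi i := by simpa using hi
    obtain ⟨-, F, hF, hflag, hF1⟩ := ih (C := C.facet i (u i) (hu i))
      (by have := dim_facet (ha := hu i) hi'; omega)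
      ⟨p, mem_boundaryPoints.2 ⟨u, w, h, mem_facet_verts.2 ⟨hu, rfl⟩,
        mem_facet_verts.2 ⟨hw, (hj i hij).symm⟩, hpb⟩⟩
    refine ⟨Function.update F (k + 1) C, by simp,
      hflag.append (hF ▸ facet_isSubface) hdim, ?_⟩
    rwa [Function.update_of_ne (by omega)]

/-- Every point of a face with boundary points lies on its resistar, or in the classification set
of the face without boundary points to which it retracts. -/
theorem mem_resistar_or_retractsTo (hn : 2 ≤ n) (hM : ∀ v : Vtx d n, M (gridPoint v) ≠ 0)
    (hb : IsBoundaryPointChoice M ne b) {k : ℕ} {C : GridFace d n} (hdim : C.dim = k)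
    (hC : (boundaryPoints M b C).Nonempty) {x : Pt d} (hx : x ∈ C.toSet) :
    (∃ F, F k = C ∧ IsFlag 1 k F ∧ (boundaryPoints M b (F 1)).Nonempty ∧
      x ∈ convexHull ℝ ((fun i => bary M b (F i)) '' Set.Icc 1 k)) ∨
    ∃ h F, h < k ∧ F k = C ∧ IsFlag h k F ∧ boundaryPoints M b (F h) = ∅ ∧
      (boundaryPoints M b (F (h + 1))).Nonempty ∧
      x ∈ convexHull ℝ (gridPoint '' (F h).verts ∪
        (fun i => bary M b (F i)) '' Set.Icc (h + 1) k) ∧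
      ∃ y ∈ (F h).toSet, RetractsTo M b x (some y) := by
  induction k generalizing C x with
  | zero => exact absurd (exists_flag hdim hC).1 (by omega)
  | succ k ih =>
    -- The barycentre has no ray of its own, so it is put on the resistar directly.
    by_cases hxb : x = bary M b C
    · obtain ⟨h1, F, hF, hflag, hF1⟩ := exists_flag hdim hC
      exact Or.inl ⟨F, hF, hflag, hF1, subset_convexHull ℝ _
        ⟨k + 1, ⟨h1, le_rfl⟩, by simp [hF, hxb]⟩⟩
    have hbary := bary_mem_relInt hn hM hb hC
    obtain ⟨F', hsub, hdim', z, hz, t, h0, h1, rfl⟩ := exists_exit hbary.1 hx hxb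
    have hdk : F'.dim = k := by omega
    have hcone : ∀ y, RetractsTo M b z (some y) →
        RetractsTo M b (t • bary M b C + (1 - t) • z) (some y) := by
      intro y hy
      rcases h0.eq_or_lt with rfl | h0
      · simpa using hy
      · exact RetractsTo.cone C z t _ hC ((subset_iff hn).2 hsub hz)
          (notMem_relInt_of_dim_lt hn (by omega) hz) h0 h1 hy
    -- An uncut exit facet starts the flag at `h = k`; otherwise the flag found for the facet is
    -- extended by `C`.
    rcases (boundaryPoints M b F').eq_empty_or_nonempty with hF' | hF'
    · right
      refine ⟨k, Function.update (fun _ => F') (k + 1) C, Nat.lt_succ_self k, by simp,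
        IsFlag.append ⟨fun i hi hi' => by omega, fun i hi hi' => by omega⟩ hsub hdim, ?_, ?_, ?_,
        z, ?_, hcone z (RetractsTo.pure F' z hF' hz)⟩
      · simpa using hF'
      · simpa using hC
      · rw [Function.update_of_ne (by omega)]
        exact combo_mem_convexHull_append le_rfl C
          (convexHull_mono Set.subset_union_left (mem_convexHull_verts hz)) h0 h1.le
      · simpa using hz
    · rcases ih hdk hF' hz with ⟨F, hF, hflag, hF1, hzF⟩ |
        ⟨h, F, hhk, hF, hflag, hFh, hFh1, hzF, y, hy, hzy⟩
      · left
        refine ⟨Function.update F (k + 1) C, by simp, hflag.append (hF ▸ hsub) hdim, ?_, ?_⟩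
        · have := (exists_flag hdk hF').1
          rwa [Function.update_of_ne (by omega)]
        · simpa using combo_mem_convexHull_append (S := ∅) (a := 1) (by omega) C
            (by simpa using hzF) h0 h1.le
      · right
        refine ⟨h, Function.update F (k + 1) C, by omega, by simp, hflag.append (hF ▸ hsub) hdim,
          ?_, ?_, ?_, y, ?_, hcone y hzy⟩
        · rwa [Function.update_of_ne (by omega)]
        · rwa [Function.update_of_ne (by omega)]
        · rw [Function.update_of_ne (by omega : h ≠ k + 1)]
          exact combo_mem_convexHull_append (by omega) C hzF h0 h1.le
        · rwa [Function.update_of_ne (by omega)]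

end Retraction

instance : Finite (GridFace d n) :=
  Finite.of_injective (fun F => (F.lo, F.hi)) fun _ _ h =>
    GridFace.ext (congrArg Prod.fst h) (congrArg Prod.snd h)

/-! ### Sides of the uncut region, and both classifications expressed by the retraction. -/

section Classification

open GridFace

variable {M : Pt d → SignType} {b : Vtx d n → Vtx d n → Pt d} {ne : ℕ}

/-- The union of the faces of the grid without boundary points. -/
def uncutRegion (M : Pt d → SignType) (b : Vtx d n → Vtx d n → Pt d) : Set (Pt d) :=
  ⋃ F ∈ {F : GridFace d n | boundaryPoints M b F = ∅}, F.toSet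

/-- The union of the faces of the grid without boundary points whose vertices have label `s`. -/
def sideRegion (M : Pt d → SignType) (b : Vtx d n → Vtx d n → Pt d) (s : SignType) : Set (Pt d) :=
  ⋃ F ∈ {F : GridFace d n | boundaryPoints M b F = ∅ ∧ ∀ v ∈ F.verts, M (gridPoint v) = s},
    F.toSet

theorem mem_uncutRegion {x : Pt d} : x ∈ uncutRegion M b ↔
    ∃ F : GridFace d n, boundaryPoints M b F = ∅ ∧ x ∈ F.toSet := by
  simp [uncutRegion]

theorem mem_sideRegion {x : Pt d} {s : SignType} : x ∈ sideRegion M b s ↔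
    ∃ F : GridFace d n, (boundaryPoints M b F = ∅ ∧ ∀ v ∈ F.verts, M (gridPoint v) = s) ∧
      x ∈ F.toSet := by
  simp [sideRegion]

theorem isClosed_sideRegion (s : SignType) : IsClosed (sideRegion M b s) :=
  (Set.toFinite _).isClosed_biUnion fun F _ => F.isClosed_toSet

theorem eq_of_mem_sideRegion (hn : 2 ≤ n) {x : Pt d} {s s' : SignType}
    (h : x ∈ sideRegion M b s) (h' : x ∈ sideRegion M b s') : s = s' := by
  rw [mem_sideRegion] at h h'
  obtain ⟨F, hF, hx⟩ := h
  obtain ⟨F', hF', hx'⟩ := h'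
  obtain ⟨v, hv, hv'⟩ := exists_common_vertex hn hx hx'
  rw [← hF.2 v hv, ← hF'.2 v hv']

theorem gridPoint_mem_sideRegion (hn : 2 ≤ n) {v : Vtx d n} {s : SignType}
    (h : gridPoint v ∈ sideRegion M b s) : M (gridPoint v) = s := by
  obtain ⟨F, hF, hx⟩ := mem_sideRegion.1 h
  exact hF.2 v ((gridPoint_mem_iff hn).1 hx)

theorem exists_mem_sideRegion (hM : ∀ v : Vtx d n, M (gridPoint v) ≠ 0) {x : Pt d}
    (hx : x ∈ uncutRegion M b) : ∃ s ≠ 0, x ∈ sideRegion M b s := by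
  obtain ⟨F, hF, hx⟩ := mem_uncutRegion.1 hx
  exact ⟨M (gridPoint F.lo), hM _,
    mem_sideRegion.2 ⟨F, ⟨hF, (boundaryPoints_eq_empty_iff hM).1 hF⟩, hx⟩⟩

/-- The two sides are disjoint closed sets that cover the uncut region, so a connected part cannot
meet both. -/
theorem mem_sideRegion_of_isPreconnected (hn : 2 ≤ n) (hM : ∀ v : Vtx d n, M (gridPoint v) ≠ 0)
    {A : Set (Pt d)} (hA : IsPreconnected A) (hAU : A ⊆ uncutRegion M b) {x y : Pt d}
    (hx : x ∈ A) (hy : y ∈ A) {s : SignType} (hs : x ∈ sideRegion M b s) :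
    y ∈ sideRegion M b s := by
  have hcover : A ⊆ sideRegion M b 1 ∪ sideRegion M b (-1) := by
    intro z hz
    obtain ⟨s, hs, hz⟩ := exists_mem_sideRegion hM (hAU hz)
    rcases s with _ | _ | _
    · exact absurd rfl hs
    · exact Or.inr hz
    · exact Or.inl hz
  have hdisj : A ∩ (sideRegion M b 1 ∩ sideRegion M b (-1)) = ∅ := by
    rw [Set.eq_empty_iff_forall_notMem]
    rintro z ⟨-, h1, h2⟩
    exact absurd (eq_of_mem_sideRegion hn h1 h2) (by decide)
  rcases isPreconnected_iff_subset_of_disjoint_closed.1 hA _ _ (isClosed_sideRegion 1)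
    (isClosed_sideRegion (-1)) hcover hdisj with h | h
  · rw [eq_of_mem_sideRegion hn hs (h hx)]; exact h hy
  · rw [eq_of_mem_sideRegion hn hs (h hx)]; exact h hy

/-- This transfers a label from grid points to an arbitrary `y`, since a retraction need not end at
a grid point. -/
theorem isLabelOf_iff (hn : 2 ≤ n) (hM : ∀ v : Vtx d n, M (gridPoint v) ≠ 0)
    {A : Set (Pt d)} (hA : IsPreconnected A) (hAU : A ⊆ uncutRegion M b) {v : Vtx d n} {y : Pt d}
    (hv : gridPoint v ∈ A) (hy : y ∈ A) {s : SignType} :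
    IsLabelOf n M A s ↔ y ∈ sideRegion M b s := by
  constructor
  · intro h
    obtain ⟨s', -, hs'⟩ := exists_mem_sideRegion hM (hAU hv)
    rw [← h.2 v hv, gridPoint_mem_sideRegion hn hs']
    exact mem_sideRegion_of_isPreconnected hn hM hA hAU hv hy hs'
  · intro h
    exact ⟨⟨v, hv⟩, fun w hw => gridPoint_mem_sideRegion hn
      (mem_sideRegion_of_isPreconnected hn hM hA hAU hy hw h)⟩

/-- The barycentre of a cut face lies in no uncut face. This turns the inclusion of `F_h` in `D`
into absence of boundary points. -/
theorem eq_empty_of_subset_uncutRegion (hn : 2 ≤ n) (hM : ∀ v : Vtx d n, M (gridPoint v) ≠ 0)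
    (hb : IsBoundaryPointChoice M ne b) {F : GridFace d n} (h : F.toSet ⊆ uncutRegion M b) :
    boundaryPoints M b F = ∅ := by
  by_contra hne
  have hF := Finset.nonempty_iff_ne_empty.2 hne
  have hmem := bary_mem_relInt hn hM hb hF
  obtain ⟨F', hF', hx⟩ := mem_uncutRegion.1 (h hmem.1)
  exact notMem_of_mem_relInt hn hF hF' hmem hx

theorem retractsTo_none_of_mem_cubeResistar (hn : 2 ≤ n)
    (hM : ∀ v : Vtx d n, M (gridPoint v) ≠ 0) (hb : IsBoundaryPointChoice M ne b)
    {C : GridFace d n} {x : Pt d} (hx : x ∈ cubeResistar M b C) : RetractsTo M b x none := by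
  obtain ⟨F, hF, hF1, hx⟩ := hx
  obtain ⟨-, hflag⟩ := (isFaceChain_iff hn).1 hF
  -- For `d = 0` the hull is that of the empty set; otherwise the first barycentre is split off as
  -- the base.
  rcases Nat.eq_zero_or_pos d with rfl | hd
  · simp at hx
  have hIcc : (fun i => bary M b (F i)) '' Set.Icc 1 d =
      {bary M b (F 1)} ∪ (fun i => bary M b (F i)) '' Set.Icc (1 + 1) d := by
    rw [← Set.image_singleton (f := fun i => bary M b (F i)), ← Set.image_union]
    congr 1
    ext i; simp only [Set.mem_Icc, Set.mem_union, Set.mem_singleton_iff]; omega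
  rw [hIcc] at hx
  obtain ⟨-, r, rfl, h⟩ := exists_retractsTo_of_mem_convexHull hn hM hb hd hflag
    (fun i hi hi' => hflag.nonempty le_rfl hF1 hi.le hi') (Set.singleton_nonempty _)
    (Set.singleton_subset_iff.2 (bary_mem_relInt hn hM hb hF1).1) (Set.mem_singleton none)
    (fun y hy => by
      rw [convexHull_singleton] at hy
      exact ⟨none, rfl, hy ▸ RetractsTo.apex _ hF1⟩) hx
  exact h

/-- The first alternative is genuine: the hulls contain barycentres, so classification sets meet the
resistar. -/
theorem exists_retractsTo_of_mem_cubeClassSet (hn : 2 ≤ n)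
    (hM : ∀ v : Vtx d n, M (gridPoint v) ≠ 0) (hb : IsBoundaryPointChoice M ne b)
    {C : GridFace d n} {D : Set (Pt d)} (hD : D ⊆ uncutRegion M b) {x : Pt d}
    (hx : x ∈ cubeClassSet M b C D) :
    RetractsTo M b x none ∨ ∃ y ∈ D, RetractsTo M b x (some y) := by
  obtain ⟨h, F, hhd, hF, hFD, hF1, hx⟩ := hx
  obtain ⟨-, hflag⟩ := (isFaceChain_iff hn).1 hF
  have hFh := eq_empty_of_subset_uncutRegion hn hM hb (hFD.trans hD)
  obtain ⟨-, r, hr, hxr⟩ := exists_retractsTo_of_mem_convexHull hn hM hb hhd.le hflag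
    (fun i hi hi' => hflag.nonempty (Nat.le_succ h) hF1 hi hi')
    (S := gridPoint '' (F h).verts) (R := insert none (some '' D))
    ⟨_, Set.mem_image_of_mem _ (F h).lo_mem_verts⟩
    ((subset_convexHull ℝ _).trans (convexHull_verts_subset hn _)) (Set.mem_insert _ _)
    (fun y hy => by
      have hy' := convexHull_verts_subset hn _ hy
      exact ⟨some y, Or.inr ⟨y, hFD hy', rfl⟩, RetractsTo.pure _ _ hFh hy'⟩) hx
  rcases hr with rfl | ⟨y, hy, rfl⟩
  · exact Or.inl hxr
  · exact Or.inr ⟨y, hy, hxr⟩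

theorem mem_cubeResistar_or_retractsTo (hn : 2 ≤ n) (hM : ∀ v : Vtx d n, M (gridPoint v) ≠ 0)
    (hb : IsBoundaryPointChoice M ne b) {C : GridFace d n} (hC : C ∈ nonemptyCubes M b) {x : Pt d}
    (hx : x ∈ C.toSet) : x ∈ cubeResistar M b C ∨
      ∃ F : GridFace d n, boundaryPoints M b F = ∅ ∧ F.toSet ⊆ C.toSet ∧
        (∀ D, F.toSet ⊆ D → x ∈ cubeClassSet M b C D) ∧
        ∃ y ∈ F.toSet, RetractsTo M b x (some y) := by
  rcases mem_resistar_or_retractsTo hn hM hb hC.1 hC.2 hx with ⟨F, hF, hflag, hF1, h⟩ |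
    ⟨h, F, hhd, hF, hflag, hFh, hF1, hx, hy⟩
  · exact Or.inl ⟨F, (isFaceChain_iff hn).2 ⟨hF, hflag⟩, hF1, h⟩
  · refine Or.inr ⟨F h, hFh, (subset_iff hn).2 (hF ▸ hflag.isSubface le_rfl hhd.le le_rfl),
      fun D hD => ⟨h, F, hhd, (isFaceChain_iff hn).2 ⟨hF, hflag⟩, hD, hF1, hx⟩, hy⟩

/-- The class of a point, read off from its retraction. -/
def HasClass (M : Pt d → SignType) (b : Vtx d n → Vtx d n → Pt d) (x : Pt d) (s : SignType) :
    Prop :=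
  (RetractsTo M b x none ∧ s = 0) ∨ ∃ y, RetractsTo M b x (some y) ∧ y ∈ sideRegion M b s

theorem HasClass.unique (hn : 2 ≤ n) (hM : ∀ v : Vtx d n, M (gridPoint v) ≠ 0)
    (hb : IsBoundaryPointChoice M ne b) {x : Pt d} {s s' : SignType} (h : HasClass M b x s)
    (h' : HasClass M b x s') : s = s' := by
  rcases h with ⟨h, rfl⟩ | ⟨y, h, hy⟩ <;> rcases h' with ⟨h', rfl⟩ | ⟨y', h', hy'⟩
  · rfl
  · exact absurd (h.unique hn hM hb h') (by simp)
  · exact absurd (h.unique hn hM hb h') (by simp)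
  · obtain rfl : y = y' := by simpa using h.unique hn hM hb h'
    exact eq_of_mem_sideRegion hn hy hy'

theorem RetractsTo.mem_uncutRegion {x y : Pt d} (h : RetractsTo M b x (some y)) :
    y ∈ uncutRegion M b := by
  generalize hr : some y = r at h
  induction h with
  | pure F x hF hx =>
    obtain rfl := Option.some.inj hr
    exact Resistar.mem_uncutRegion.2 ⟨F, hF, hx⟩
  | apex F hF => simp at hr
  | cone F z t r hF hz hz' h0 h1 h ih => exact ih hr

theorem hasClass_of_mem_sideRegion {x : Pt d} {s : SignType} (h : x ∈ sideRegion M b s) :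
    HasClass M b x s := by
  obtain ⟨F, hF, hx⟩ := mem_sideRegion.1 h
  exact Or.inr ⟨x, RetractsTo.pure F x hF.1 hx, h⟩

theorem exists_retractsTo (hn : 2 ≤ n) (hM : ∀ v : Vtx d n, M (gridPoint v) ≠ 0)
    (hb : IsBoundaryPointChoice M ne b) {x : Pt d} (hx : x ∈ unitCube d) :
    ∃ r, RetractsTo M b x r := by
  obtain ⟨C, hC, hxC⟩ := exists_cube_of_mem_unitCube hn hx
  rcases (boundaryPoints M b C).eq_empty_or_nonempty with h | h
  · exact ⟨_, RetractsTo.pure C x h hxC⟩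
  · rcases mem_cubeResistar_or_retractsTo hn hM hb ⟨hC, h⟩ hxC with h | ⟨-, -, -, -, y, -, h⟩
    · exact ⟨_, retractsTo_none_of_mem_cubeResistar hn hM hb h⟩
    · exact ⟨_, h⟩

theorem existsUnique_hasClass (hn : 2 ≤ n) (hM : ∀ v : Vtx d n, M (gridPoint v) ≠ 0)
    (hb : IsBoundaryPointChoice M ne b) {x : Pt d} (hx : x ∈ unitCube d) :
    ∃! s, HasClass M b x s := by
  refine existsUnique_of_exists_of_unique ?_ fun s s' h h' => h.unique hn hM hb h'
  obtain ⟨_ | y, h⟩ := exists_retractsTo hn hM hb hx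
  · exact ⟨0, Or.inl ⟨h, rfl⟩⟩
  · obtain ⟨s, -, hs⟩ := exists_mem_sideRegion hM h.mem_uncutRegion
    exact ⟨s, Or.inr ⟨y, h, hs⟩⟩

theorem eq_connectedComponentIn_of_mem {U D : Set (Pt d)} (hD : D ∈ components U) {y : Pt d}
    (hy : y ∈ D) : D = connectedComponentIn U y := by
  obtain ⟨x, -, rfl⟩ := hD
  exact connectedComponentIn_eq hy

theorem subset_of_mem_components {U D : Set (Pt d)} (hD : D ∈ components U) : D ⊆ U := by
  obtain ⟨x, -, rfl⟩ := hD
  exact connectedComponentIn_subset U x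

theorem isPreconnected_of_mem_components {U D : Set (Pt d)} (hD : D ∈ components U) :
    IsPreconnected D := by
  obtain ⟨x, -, rfl⟩ := hD
  exact isPreconnected_connectedComponentIn

theorem GridFace.subset_connectedComponentIn {F : GridFace d n} {U : Set (Pt d)}
    (h : F.toSet ⊆ U) {y : Pt d} (hy : y ∈ F.toSet) : F.toSet ⊆ connectedComponentIn U y :=
  F.convex_toSet.isPreconnected.subset_connectedComponentIn hy h

theorem subset_uncutRegion_of_mem_cubeComponents {C : GridFace d n} {D : Set (Pt d)}
    (hD : D ∈ cubeComponents M b C) : D ⊆ uncutRegion M b := by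
  refine (subset_of_mem_components hD).trans ?_
  exact Set.biUnion_subset_biUnion_left fun F hF => hF.2

/-- `HasClass` does not mention `C`, so all cut cubes that contain `x` agree. -/
theorem isCubeClass_iff (hn : 2 ≤ n) (hM : ∀ v : Vtx d n, M (gridPoint v) ≠ 0)
    (hb : IsBoundaryPointChoice M ne b) {C : GridFace d n} (hC : C ∈ nonemptyCubes M b) {x : Pt d}
    (hx : x ∈ C.toSet) {s : SignType} : IsCubeClass M b C x s ↔ HasClass M b x s := by
  have htotal := mem_cubeResistar_or_retractsTo hn hM hb hC hx
  have hres : RetractsTo M b x none → x ∈ cubeResistar M b C := by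
    intro h
    rcases htotal with h' | ⟨-, -, -, -, y, -, h'⟩
    · exact h'
    · exact absurd (h.unique hn hM hb h') (by simp)
  constructor
  · rintro (⟨h, -⟩ | ⟨-, ⟨h, rfl⟩ | ⟨h, D, hD, hxD, -, hs⟩⟩)
    · exact absurd h hC.2.ne_empty
    · exact Or.inl ⟨retractsTo_none_of_mem_cubeResistar hn hM hb h, rfl⟩
    · have hDU := subset_uncutRegion_of_mem_cubeComponents hD
      rcases exists_retractsTo_of_mem_cubeClassSet hn hM hb hDU hxD with h' | ⟨y, hy, h'⟩
      · exact absurd (hres h') h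
      · obtain ⟨v, hv⟩ := hs.1
        exact Or.inr ⟨y, h', (isLabelOf_iff hn hM (isPreconnected_of_mem_components hD) hDU
          hv hy).1 hs⟩
  · rintro (⟨h, rfl⟩ | ⟨y, h, hy⟩)
    · exact Or.inr ⟨hC.2, Or.inl ⟨hres h, rfl⟩⟩
    · have hnot : ¬ RetractsTo M b x none := fun h' => absurd (h.unique hn hM hb h') (by simp)
      have hxr : x ∉ cubeResistar M b C := fun h' =>
        hnot (retractsTo_none_of_mem_cubeResistar hn hM hb h')
      refine Or.inr ⟨hC.2, Or.inr ⟨hxr, ?_⟩⟩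
      obtain ⟨F, hF, hFC, hclass, y', hyF, hxy⟩ := htotal.resolve_left hxr
      obtain rfl : y = y' := by simpa using h.unique hn hM hb hxy
      have hFU : F.toSet ⊆ ⋃ F ∈ {F : GridFace d n | F.toSet ⊆ C.toSet ∧
          boundaryPoints M b F = ∅}, F.toSet :=
        Set.subset_biUnion_of_mem (u := fun F : GridFace d n => F.toSet) ⟨hFC, hF⟩
      have hD : connectedComponentIn (⋃ F ∈ {F : GridFace d n | F.toSet ⊆ C.toSet ∧
          boundaryPoints M b F = ∅}, F.toSet) y ∈ cubeComponents M b C := ⟨y, hFU hyF, rfl⟩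
      have hFD := GridFace.subset_connectedComponentIn hFU hyF
      refine ⟨_, hD, hclass _ hFD, fun D' hD' hx' => ?_,
        (isLabelOf_iff hn hM (isPreconnected_of_mem_components hD)
          (subset_uncutRegion_of_mem_cubeComponents hD) (hFD (F.gridPoint_lo_mem hn))
          (hFD hyF)).2 hy⟩
      -- Any competing component contains the same endpoint `y`, and a component is determined by
      -- one of its points.
      rcases exists_retractsTo_of_mem_cubeClassSet hn hM hb
        (subset_uncutRegion_of_mem_cubeComponents hD') hx' with h' | ⟨y', hy', h'⟩
      · exact absurd h' hnot
      · obtain rfl : y = y' := by simpa using h.unique hn hM hb h'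
        exact eq_connectedComponentIn_of_mem hD' hy'

/-- The set `D ∩ C` need not be connected; its inclusion in the uncut region is enough. -/
theorem exists_retractsTo_of_mem_gridClassSet (hn : 2 ≤ n)
    (hM : ∀ v : Vtx d n, M (gridPoint v) ≠ 0) (hb : IsBoundaryPointChoice M ne b)
    {D : Set (Pt d)} (hD : D ⊆ uncutRegion M b) {x : Pt d} (hx : x ∈ gridClassSet M b D) :
    RetractsTo M b x none ∨ ∃ y ∈ D, RetractsTo M b x (some y) := by
  obtain ⟨C, -, hx⟩ := Set.mem_iUnion₂.1 hx
  unfold gridClassPiece at hx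
  split_ifs at hx with h1 h2
  · simp at hx
  · have hCD := Set.inter_eq_right.1 h2
    exact Or.inr ⟨x, hCD hx, RetractsTo.pure C x
      (eq_empty_of_subset_uncutRegion hn hM hb (hCD.trans hD)) hx⟩
  · rcases exists_retractsTo_of_mem_cubeClassSet hn hM hb (Set.inter_subset_left.trans hD) hx with
      h | ⟨y, hy, h⟩
    · exact Or.inl h
    · exact Or.inr ⟨y, hy.1, h⟩

theorem mem_gridResistar_or_retractsTo (hn : 2 ≤ n) (hM : ∀ v : Vtx d n, M (gridPoint v) ≠ 0)
    (hb : IsBoundaryPointChoice M ne b) {x : Pt d} (hx : x ∈ unitCube d) :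
    x ∈ gridResistar M b ∨ ∃ F : GridFace d n, boundaryPoints M b F = ∅ ∧
      (∀ D ⊆ uncutRegion M b, F.toSet ⊆ D → x ∈ gridClassSet M b D) ∧
      ∃ y ∈ F.toSet, RetractsTo M b x (some y) := by
  obtain ⟨C, hC, hxC⟩ := exists_cube_of_mem_unitCube hn hx
  rcases (boundaryPoints M b C).eq_empty_or_nonempty with h | h
  · refine Or.inr ⟨C, h, fun D hDU hD => Set.mem_biUnion hC ?_, x, hxC, RetractsTo.pure C x h hxC⟩
    have hDC := Set.inter_eq_right.2 hD
    rw [gridClassPiece, if_neg, if_pos hDC]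
    · exact hxC
    · rw [hDC]; exact Set.Nonempty.ne_empty ⟨x, hxC⟩
  · rcases mem_cubeResistar_or_retractsTo hn hM hb ⟨hC, h⟩ hxC with h' | ⟨F, hF, hFC, hcl, hy⟩
    · exact Or.inl (Set.mem_biUnion (x := C) ⟨hC, h⟩ h')
    · refine Or.inr ⟨F, hF, fun D hDU hD => Set.mem_biUnion hC ?_, hy⟩
      rw [gridClassPiece, if_neg, if_neg]
      · exact hcl _ (Set.subset_inter hD hFC)
      -- A cube inside the uncut region would itself be uncut.
      · intro hDC
        exact h.ne_empty (eq_empty_of_subset_uncutRegion hn hM hb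
          ((Set.inter_eq_right.1 hDC).trans hDU))
      · exact Set.Nonempty.ne_empty ⟨_, hD (F.gridPoint_lo_mem hn), hFC (F.gridPoint_lo_mem hn)⟩

theorem isGridClass_iff (hn : 2 ≤ n) (hM : ∀ v : Vtx d n, M (gridPoint v) ≠ 0)
    (hb : IsBoundaryPointChoice M ne b) {x : Pt d} (hx : x ∈ unitCube d) {s : SignType} :
    IsGridClass M b x s ↔ HasClass M b x s := by
  have htotal := mem_gridResistar_or_retractsTo hn hM hb hx
  have hnone : x ∈ gridResistar M b → RetractsTo M b x none := by
    intro h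
    obtain ⟨C, -, h⟩ := Set.mem_iUnion₂.1 h
    exact retractsTo_none_of_mem_cubeResistar hn hM hb h
  have hres : RetractsTo M b x none → x ∈ gridResistar M b := by
    intro h
    rcases htotal with h' | ⟨-, -, -, y, -, h'⟩
    · exact h'
    · exact absurd (h.unique hn hM hb h') (by simp)
  constructor
  · rintro (⟨h, rfl⟩ | ⟨h, D, hD, hxD, -, hs⟩)
    · exact Or.inl ⟨hnone h, rfl⟩
    · have hDU : D ⊆ uncutRegion M b := subset_of_mem_components hD
      rcases exists_retractsTo_of_mem_gridClassSet hn hM hb hDU hxD with h' | ⟨y, hy, h'⟩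
      · exact absurd (hres h') h
      · obtain ⟨v, hv⟩ := hs.1
        exact Or.inr ⟨y, h', (isLabelOf_iff hn hM (isPreconnected_of_mem_components hD) hDU
          hv hy).1 hs⟩
  · rintro (⟨h, rfl⟩ | ⟨y, h, hy⟩)
    · exact Or.inl ⟨hres h, rfl⟩
    · have hnot : ¬ RetractsTo M b x none := fun h' => absurd (h.unique hn hM hb h') (by simp)
      have hxr : x ∉ gridResistar M b := fun h' => hnot (hnone h')
      refine Or.inr ⟨hxr, ?_⟩
      obtain ⟨F, hF, hclass, y', hyF, hxy⟩ := htotal.resolve_left hxr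
      obtain rfl : y = y' := by simpa using h.unique hn hM hb hxy
      have hFU : F.toSet ⊆ uncutRegion M b := fun z hz => mem_uncutRegion.2 ⟨F, hF, hz⟩
      have hD : connectedComponentIn (uncutRegion M b) y ∈ gridComponents M b := ⟨y, hFU hyF, rfl⟩
      have hFD := GridFace.subset_connectedComponentIn hFU hyF
      have hDU := connectedComponentIn_subset (uncutRegion M b) y
      refine ⟨_, hD, hclass _ hDU hFD, fun D' hD' hx' => ?_,
        (isLabelOf_iff hn hM (isPreconnected_of_mem_components hD) hDU
          (hFD (F.gridPoint_lo_mem hn)) (hFD hyF)).2 hy⟩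
      rcases exists_retractsTo_of_mem_gridClassSet hn hM hb (subset_of_mem_components hD') hx' with
        h' | ⟨y', hy', h'⟩
      · exact absurd h' hnot
      · obtain rfl : y = y' := by simpa using h.unique hn hM hb h'
        exact eq_connectedComponentIn_of_mem hD' hy'

end Classification

/-! ### The first cut cube on the segment. -/

section Algorithm

open GridFace

variable {M : Pt d → SignType} {b : Vtx d n → Vtx d n → Pt d} {ne : ℕ}

theorem isClosed_uncutRegion : IsClosed (uncutRegion M b) :=
  (Set.toFinite _).isClosed_biUnion fun F _ => F.isClosed_toSet

theorem segment_subset_unitCube (hn : 2 ≤ n) (C : GridFace d n) {x : Pt d}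
    (hx : x ∈ unitCube d) : segment ℝ x C.centre ⊆ unitCube d :=
  convex_unitCube.segment_subset hx (C.toSet_subset_unitCube hn (C.centre_mem hn))

/-- The class is constant along a segment up to the first point of a cube with boundary points. -/
theorem hasClass_iff_of_nearest (hn : 2 ≤ n) (hM : ∀ v : Vtx d n, M (gridPoint v) ≠ 0)
    (hb : IsBoundaryPointChoice M ne b) {x m p : Pt d} (hseg : segment ℝ x m ⊆ unitCube d)
    (hp : p ∈ segment ℝ x m)
    (hmin : ∀ C ∈ nonemptyCubes M b, ∀ y ∈ segment ℝ x m ∩ C.toSet, ‖x - p‖ ≤ ‖x - y‖)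
    {s : SignType} : HasClass M b p s ↔ HasClass M b x s := by
  rcases eq_or_ne p x with rfl | hne
  · rfl
  have hnorm : 0 < ‖p - x‖ := norm_pos_iff.2 (sub_ne_zero.2 hne)
  have hsub : segment ℝ x p ⊆ segment ℝ x m :=
    (convex_segment x m).segment_subset (left_mem_segment ℝ x m) hp
  -- A cut cube met strictly before `p` would contradict the minimality of `‖x - p‖`.
  have hIco : Set.Ico (0 : ℝ) 1 ⊆ AffineMap.lineMap x p ⁻¹' uncutRegion M b := by
    intro t ht
    have hq : AffineMap.lineMap x p t ∈ segment ℝ x m := by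
      apply hsub
      rw [segment_eq_image_lineMap]
      exact ⟨t, ⟨ht.1, ht.2.le⟩, rfl⟩
    obtain ⟨C, hC, hqC⟩ := exists_cube_of_mem_unitCube hn (hseg hq)
    refine mem_uncutRegion.2 ⟨C, ?_, hqC⟩
    by_contra hCne
    have hle := hmin C ⟨hC, Finset.nonempty_iff_ne_empty.2 hCne⟩ _ ⟨hq, hqC⟩
    rw [← dist_eq_norm x, ← dist_eq_norm x, dist_left_lineMap, Real.norm_of_nonneg ht.1,
      dist_comm, dist_eq_norm] at hle
    nlinarith [ht.2]
  -- The point `p` may lie in a cut cube; it is reached as a limit, since the region is closed.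
  have hU : segment ℝ x p ⊆ uncutRegion M b := by
    rw [segment_eq_image_lineMap, Set.image_subset_iff, ← closure_Ico zero_ne_one]
    exact closure_minimal hIco (isClosed_uncutRegion.preimage AffineMap.lineMap_continuous)
  obtain ⟨s', -, hs'⟩ := exists_mem_sideRegion hM (hU (left_mem_segment ℝ x p))
  have h1 := hasClass_of_mem_sideRegion hs'
  have h2 := hasClass_of_mem_sideRegion (mem_sideRegion_of_isPreconnected hn hM
    (convex_segment x p).isPreconnected hU (left_mem_segment ℝ x p) (right_mem_segment ℝ x p) hs')
  constructor
  · intro h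
    rwa [h.unique hn hM hb h2]
  · intro h
    rwa [h.unique hn hM hb h1]

theorem isCubeClass_nearest_iff (hn : 2 ≤ n) (hM : ∀ v : Vtx d n, M (gridPoint v) ≠ 0)
    (hb : IsBoundaryPointChoice M ne b) {x m : Pt d} (hseg : segment ℝ x m ⊆ unitCube d)
    {x' : GridFace d n → Pt d} {C' : GridFace d n}
    (hx' : ∀ C ∈ cubesOnSegment M b m x, x' C ∈ segment ℝ x m ∩ C.toSet ∧
      ∀ y ∈ segment ℝ x m ∩ C.toSet, ‖x - x' C‖ ≤ ‖x - y‖)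
    (hC' : C' ∈ cubesOnSegment M b m x)
    (hmin : ∀ C ∈ cubesOnSegment M b m x, ‖x - x' C'‖ ≤ ‖x - x' C‖) {s : SignType} :
    IsCubeClass M b C' (x' C') s ↔ HasClass M b x s := by
  rw [isCubeClass_iff hn hM hb hC'.1 (hx' C' hC').1.2]
  refine hasClass_iff_of_nearest hn hM hb hseg (hx' C' hC').1.1 fun C hC y hy => ?_
  have hCs : C ∈ cubesOnSegment M b m x := ⟨hC, y, hy.2, hy.1⟩
  exact (hmin C hCs).trans ((hx' C hCs).2 y hy)

/-- Compactness gives a nearest point in each cube, and finiteness of the grid a best cube. -/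
theorem exists_nearest {m x : Pt d} (hne : (cubesOnSegment M b m x).Nonempty) :
    ∃ (x' : GridFace d n → Pt d) (C' : GridFace d n),
      (∀ C ∈ cubesOnSegment M b m x, x' C ∈ segment ℝ x m ∩ C.toSet ∧
        ∀ y ∈ segment ℝ x m ∩ C.toSet, ‖x - x' C‖ ≤ ‖x - y‖) ∧
      C' ∈ cubesOnSegment M b m x ∧
      ∀ C ∈ cubesOnSegment M b m x, ‖x - x' C'‖ ≤ ‖x - x' C‖ := by
  have hcomp : IsCompact (segment ℝ x m) := by
    rw [segment_eq_image_lineMap]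
    exact isCompact_Icc.image AffineMap.lineMap_continuous
  choose! x' hx' using fun C (hC : C ∈ cubesOnSegment M b m x) =>
    (hcomp.inter_right C.isClosed_toSet).exists_isMinOn (Set.inter_comm _ _ ▸ hC.2)
      (f := fun y => ‖x - y‖) (by fun_prop)
  obtain ⟨C', hC', hmin⟩ := Set.exists_min_image _ (fun C => ‖x - x' C‖) (Set.toFinite _) hne
  exact ⟨x', C', fun C hC => ⟨(hx' C hC).1, fun y hy => (hx' C hC).2 hy⟩, hC', hmin⟩

end Algorithm

end Resistar

theorem mainTheorem5 (d n ne : ℕ) (hn : 2 ≤ n) (hne : 1 ≤ ne)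
    (M : Resistar.Pt d → SignType)
    (hM : ∀ v : Resistar.Vtx d n, M (Resistar.gridPoint v) ≠ 0)
    (b : Resistar.Vtx d n → Resistar.Vtx d n → Resistar.Pt d)
    (hb : Resistar.IsBoundaryPointChoice M ne b)
    (Cm : Resistar.GridFace d n) (hCm : Cm ∈ Resistar.nonemptyCubes M b)
    (x : Resistar.Pt d) (hx : x ∈ Resistar.unitCube d) :
    (∃! s : SignType, Resistar.IsGridClass M b x s) ∧
      ∀ s : SignType,
        Resistar.AlgorithmReturns M b Cm.centre x s ↔ Resistar.IsGridClass M b x s := by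
  simp only [Resistar.isGridClass_iff hn hM hb hx]
  refine ⟨Resistar.existsUnique_hasClass hn hM hb hx, fun s => ?_⟩
  have hseg := Resistar.segment_subset_unitCube hn Cm hx
  constructor
  · rintro ⟨x', C', hx', hC', hmin, h⟩
    exact (Resistar.isCubeClass_nearest_iff hn hM hb hseg hx' hC' hmin).1 h
  · intro h
    -- The reference cube meets the segment at its centre, so the algorithm always has a candidate.
    obtain ⟨x', C', hx', hC', hmin⟩ := Resistar.exists_nearest (M := M) (b := b)
      (m := Cm.centre) (x := x) ⟨Cm, hCm, Cm.centre, Cm.centre_mem hn, right_mem_segment ℝ _ _⟩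
    exact ⟨x', C', hx', hC', hmin,
      (Resistar.isCubeClass_nearest_iff hn hM hb hseg hx' hC' hmin).2 h⟩
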